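/- Let $k$ be an algebraically closed field of arbitrary characteristic and let $R$ be a commutative ring. Let $\chi$ be an $R$-valued Euler characteristic on constructible sets, that is, a map assigning to each constructible subset of $k^n$ ($n\ge 0$) an element of $R$ such that: $\chi(A\sqcup B)=\chi(A)+\chi(B)$ for disjoint constructible $A,B\subseteq k^n$; $\chi(A\times B)=\chi(A)\chi(B)$; $\chi(A)=\chi(B)$ whenever there is a bijection $A\to B$ whose graph is constructible; and $\chi(\mathrm{point})=1$. Then $\chi$ extends uniquely to an additive function on the constructible sets of closed points of any variety $V$ over $k$, computed on subsets of affine opens through closed embeddings into affine space. Let $\int_V\cdot\,d\chi$ be the $R$-linear map, on the $R$-span of the characteristic functions of constructible subsets of $V$ (the integrable functions), with $\int_V 1_A\,d\chi=\chi(A)$. Let $C_1,C_2$ be smooth projective irreducible curves over $k$, and let $\phi:C_1\to C_2$ be a separable morphism over $k$, i.e. $\phi$ is dominant (equivalently, non-constant) and the extension of function fields $K(C_1)/K(C_2)$ is separable. Let $\deg\phi=[K(C_1):K(C_2)]$ and, for a closed point $x\in C_1$, let $e_x(\phi)$ be the ramification index of $\mathcal O_{C_1,x}$ over $\mathcal O_{C_2,\phi(x)}$.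 Say that Fubini's theorem holds for $\phi$ if for every closed point $y\in C_2$ the fibre $\phi^{-1}(y)$ is constructible, the function $y\mapsto\chi(\phi^{-1}(y))$ is integrable on $C_2$, and $\chi(C_1)=\int_{C_2}\chi(\phi^{-1}(y))\,d\chi(y)$. Then $e_x(\phi)=1$ for all but finitely many closed points $x\in C_1$, and Fubini's theorem holds for $\phi$ if and only if $$\chi(C_1)=\chi(C_2)\deg\phi-\sum_{x\in C_1}(e_x(\phi)-1)$$ in $R$, where the sum is over the closed points of $C_1$. -/

import Mathlib

open AlgebraicGeometry CategoryTheory TopologicalSpace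

universe u v

noncomputable section

namespace EulerFubini

/-! ### Constructible sets and Euler characteristics -/

/-- Constructible subsets of `kⁿ`: the algebra of sets generated by the Zariski closed sets. -/
def IsConstructibleSet {k : Type u} [Field k] {n : ℕ} (S : Set (Fin n → k)) : Prop :=
  S ∈ BooleanSubalgebra.closure
    {Z : Set (Fin n → k) | ∃ I : Ideal (MvPolynomial (Fin n) k), Z = MvPolynomial.zeroLocus k I}

/-- The product `A × B`, as a subset of `kⁿ⁺ᵐ`. -/
def prodSet {k : Type u} {n m : ℕ} (A : Set (Fin n → k)) (B : Set (Fin m → k)) :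
    Set (Fin (n + m) → k) :=
  {z | (fun i => z (Fin.castAdd m i)) ∈ A ∧ (fun j => z (Fin.natAdd n j)) ∈ B}

/-- The graph in `kⁿ⁺ᵐ` of the restriction of `f` to `A`. -/
def graphOn {k : Type u} {n m : ℕ} (A : Set (Fin n → k)) (f : (Fin n → k) → (Fin m → k)) :
    Set (Fin (n + m) → k) :=
  {z | (fun i => z (Fin.castAdd m i)) ∈ A ∧
    (fun j => z (Fin.natAdd n j)) = f (fun i => z (Fin.castAdd m i))}

/-- An `R`-valued Euler characteristic on the structure of constructible sets over `k`,
normalised so that a point has Euler characteristic one. Only the values on constructible sets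
matter. -/
structure EulerCharacteristic (k : Type u) [Field k] (R : Type v) [CommRing R] where
  /-- the value on a subset of `kⁿ` -/
  val : ∀ {n : ℕ}, Set (Fin n → k) → R
  union : ∀ {n : ℕ} (A B : Set (Fin n → k)), IsConstructibleSet A → IsConstructibleSet B →
    Disjoint A B → val (A ∪ B) = val A + val B
  prod : ∀ {n m : ℕ} (A : Set (Fin n → k)) (B : Set (Fin m → k)),
    IsConstructibleSet A → IsConstructibleSet B → val (prodSet A B) = val A * val B
  bij : ∀ {n m : ℕ} (A : Set (Fin n → k)) (B : Set (Fin m → k)) (f : (Fin n → k) → (Fin m → k)),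
    IsConstructibleSet A → IsConstructibleSet B → IsConstructibleSet (graphOn A f) →
    Set.BijOn f A B → val A = val B
  point : val (Set.univ : Set (Fin 0 → k)) = 1

/-! ### Varieties and curves -/

/-- An irreducible (separated) algebraic variety over `k`. -/
structure Variety (k : Type u) [Field k] where
  /-- the underlying scheme -/
  X : Scheme.{u}
  /-- the structure morphism -/
  str : X ⟶ Spec (.of k)
  isIntegral : IsIntegral X
  isSeparated : IsSeparated str
  locallyOfFiniteType : LocallyOfFiniteType str
  quasiCompact : QuasiCompact str

attribute [instance] Variety.isIntegral Variety.isSeparated Variety.locallyOfFiniteType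
  Variety.quasiCompact

attribute [local instance] MvPolynomial.gradedAlgebra

/-- Projective space `ℙⁿ` over `k`. -/
def projSpace (k : Type u) [Field k] (n : ℕ) : Scheme.{u} :=
  Proj (MvPolynomial.homogeneousSubmodule (Fin (n + 1)) k)

/-- The structure morphism of `ℙⁿ`. -/
def projSpaceStr (k : Type u) [Field k] (n : ℕ) : projSpace k n ⟶ Spec (.of k) :=
  Proj.toSpecZero (MvPolynomial.homogeneousSubmodule (Fin (n + 1)) k) ≫
    Spec.map (CommRingCat.ofHom
      (algebraMap k (MvPolynomial.homogeneousSubmodule (Fin (n + 1)) k 0)))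

/-- A smooth projective irreducible curve over `k`. -/
structure ProjectiveCurve (k : Type u) [Field k] extends Variety k where
  smooth : SmoothOfRelativeDimension 1 str
  projective : ∃ (n : ℕ) (i : X ⟶ projSpace k n), IsClosedImmersion i ∧ i ≫ projSpaceStr k n = str

/-- The closed points of a variety, with the Zariski topology. -/
abbrev Variety.Pt {k : Type u} [Field k] (V : Variety k) : Type u :=
  {x : V.X // IsClosed ({x} : Set V.X)}

/-- Constructible subsets of a variety: the algebra of sets generated by the closed sets. -/
def Variety.IsConstructible {k : Type u} [Field k] (V : Variety k) (S : Set V.Pt) : Prop :=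
  S ∈ BooleanSubalgebra.closure {Z : Set V.Pt | IsClosed Z}

/-! ### Extension of an Euler characteristic to varieties -/

/-- The ring homomorphism `k → Γ(V, U)`. -/
def Variety.scalars {k : Type u} [Field k] (V : Variety k) (U : V.X.Opens) : k →+* Γ(V.X, U) :=
  ((Scheme.ΓSpecIso (.of k)).inv ≫ V.str.appLE ⊤ U (show U ≤ V.str ⁻¹ᵁ ⊤ from le_top)).hom

/-- The `k`-point `Spec k ⟶ V` given by a closed point. -/
def Variety.kpoint {k : Type u} [Field k] [IsAlgClosed k] (V : Variety k) (x : V.Pt) :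
    Spec (.of k) ⟶ V.X :=
  pointOfClosedPoint V.str x.1 x.2

theorem Variety.le_preimage_kpoint {k : Type u} [Field k] [IsAlgClosed k] (V : Variety k)
    {U : V.X.Opens} (x : V.Pt) (hx : x.1 ∈ U) : ⊤ ≤ V.kpoint x ⁻¹ᵁ U := by
  intro a _
  change V.kpoint x a ∈ U
  rw [Variety.kpoint, pointOfClosedPoint_apply]
  exact hx

/-- The evaluation `Γ(V, U) → k` at a closed point `x ∈ U`: the pullback of sections along the
`k`-point given by `x`. -/
def Variety.value {k : Type u} [Field k] [IsAlgClosed k] (V : Variety k) {U : V.X.Opens}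
    (x : V.Pt) (hx : x.1 ∈ U) : Γ(V.X, U) →+* k :=
  ((V.kpoint x).appLE U ⊤ (V.le_preimage_kpoint x hx) ≫ (Scheme.ΓSpecIso (.of k)).hom).hom

/-- A finite affine open cover `U₁, …, Uᵣ` of `V`, each `Uⱼ` with a closed embedding into an affine
space, given by generators of the `k`-algebra `Γ(V, Uⱼ)`. -/
structure Variety.Atlas {k : Type u} [Field k] (V : Variety k) where
  /-- number of charts -/
  r : ℕ
  /-- the affine opens -/
  U : Fin r → V.X.Opens
  affine : ∀ j, IsAffineOpen (U j)
  cover : ∀ x : V.X, ∃ j, x ∈ U j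
  /-- dimension of the ambient affine spaces -/
  d : Fin r → ℕ
  /-- coordinate functions -/
  coord : ∀ j, Fin (d j) → Γ(V.X, U j)
  surj : ∀ j, Function.Surjective (MvPolynomial.eval₂Hom (V.scalars (U j)) (coord j))

theorem Variety.nonempty_atlas {k : Type u} [Field k] (V : Variety k) : Nonempty V.Atlas := by
  have hc : CompactSpace V.X := by
    have := QuasiCompact.compactSpace_of_compactSpace V.str
    exact this
  obtain ⟨t, ht⟩ := isCompact_univ.elim_finite_subcover (ι := V.X.affineOpens)
    (fun U => ((U : V.X.Opens) : Set V.X)) (fun U => U.1.isOpen) (by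
      intro x _
      obtain ⟨U, hU, hx, _⟩ := Opens.isBasis_iff_nbhd.mp V.X.isBasis_affineOpens
        (show x ∈ (⊤ : V.X.Opens) from trivial)
      exact Set.mem_iUnion.mpr ⟨⟨U, hU⟩, hx⟩)
  have key : ∀ U : V.X.affineOpens, ∃ (d : ℕ) (c : Fin d → Γ(V.X, U.1)),
      Function.Surjective (MvPolynomial.eval₂Hom (V.scalars U.1) c) := by
    intro U
    have h1 : (V.str.appLE ⊤ U.1 (show U.1 ≤ V.str ⁻¹ᵁ ⊤ from le_top)).hom.FiniteType :=
      V.str.finiteType_appLE (isAffineOpen_top _) U.2 le_top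
    have h2 : (V.scalars U.1).FiniteType := by
      unfold Variety.scalars
      rw [CommRingCat.hom_comp]
      refine h1.comp (RingHom.FiniteType.of_surjective _ ?_)
      exact (ConcreteCategory.bijective_of_isIso (Scheme.ΓSpecIso (.of k)).inv).2
    let := (V.scalars U.1).toAlgebra
    have h3 : Algebra.FiniteType k Γ(V.X, U.1) := h2
    obtain ⟨d, f, hf⟩ := Algebra.FiniteType.iff_quotient_mvPolynomial''.mp h3
    refine ⟨d, fun i => f (MvPolynomial.X i), ?_⟩
    have : (MvPolynomial.eval₂Hom (V.scalars U.1) fun i => f (MvPolynomial.X i))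
        = f.toRingHom := by
      apply MvPolynomial.ringHom_ext
      · intro a
        simp only [MvPolynomial.coe_eval₂Hom, MvPolynomial.eval₂_C]
        exact (f.commutes a).symm
      · intro i
        simp
    rw [this]
    exact hf
  choose d c hdc using key
  exact ⟨{
    r := t.card
    U := fun j => (t.equivFin.symm j).1.1
    affine := fun j => (t.equivFin.symm j).1.2
    cover := by
      intro x
      obtain ⟨U, hU⟩ := Set.mem_iUnion.mp (ht (Set.mem_univ x))
      obtain ⟨hUt, hx⟩ := Set.mem_iUnion.mp hU
      exact ⟨t.equivFin ⟨U, hUt⟩, by simpa using hx⟩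
    d := fun j => d _
    coord := fun j => c _
    surj := fun j => hdc _ }⟩

/-- The point of affine space with coordinates `c₁(x), …, c_d(x)`. -/
def Variety.coords {k : Type u} [Field k] [IsAlgClosed k] (V : Variety k) {U : V.X.Opens} {d : ℕ}
    (c : Fin d → Γ(V.X, U)) (x : V.Pt) (hx : x.1 ∈ U) : Fin d → k :=
  fun i => V.value x hx (c i)

/-- The image of `S ∩ U` under the map `U → kᵈ` given by sections `c₁, …, c_d` over `U`. -/
def Variety.chartImage {k : Type u} [Field k] [IsAlgClosed k] (V : Variety k) {U : V.X.Opens}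
    {d : ℕ} (c : Fin d → Γ(V.X, U)) (S : Set V.Pt) : Set (Fin d → k) :=
  {p | ∃ (x : V.Pt) (hx : x.1 ∈ U), x ∈ S ∧ V.coords c x hx = p}

/-- The closed points that lie in `Uⱼ` but in no earlier `Uₗ`. -/
def Variety.Atlas.stratum {k : Type u} [Field k] {V : Variety k} (𝒜 : V.Atlas) (j : Fin 𝒜.r) :
    Set V.Pt :=
  {x | x.1 ∈ 𝒜.U j ∧ ∀ l < j, x.1 ∉ 𝒜.U l}

/-- The Euler characteristic of `S ⊆ V`, computed in an atlas by cutting `S` into pieces lying in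
affine charts. On constructible sets it does not depend on the atlas, see `inAtlas_eq`. -/
def EulerCharacteristic.inAtlas {k : Type u} [Field k] [IsAlgClosed k] {R : Type v} [CommRing R]
    (χ : EulerCharacteristic k R) {V : Variety k} (𝒜 : V.Atlas) (S : Set V.Pt) : R :=
  ∑ j, χ.val (V.chartImage (𝒜.coord j) (S ∩ 𝒜.stratum j))

/-- The extension of `χ` to the constructible subsets of a variety. It is additive and is computed
by any closed embedding of an affine open subset, see `ofVariety_union` and `ofVariety_eq_val`. -/
def EulerCharacteristic.ofVariety {k : Type u} [Field k] [IsAlgClosed k] {R : Type v} [CommRing R]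
    (χ : EulerCharacteristic k R) (V : Variety k) (S : Set V.Pt) : R :=
  χ.inAtlas (Classical.choice V.nonempty_atlas) S

/-! ### The extension is well defined, additive, and computed by affine charts -/

section WellDefined

theorem finsetSup_mem {α ι : Type*} [BooleanAlgebra α] {L : BooleanSubalgebra α} {s : Finset ι}
    {f : ι → α} (h : ∀ i ∈ s, f i ∈ L) : s.sup f ∈ L :=
  Finset.sup_induction (p := fun a => a ∈ L) BooleanSubalgebra.bot_mem
    (fun _ ha _ hb => BooleanSubalgebra.sup_mem ha hb) h

theorem finsetInf_mem {α ι : Type*} [BooleanAlgebra α] {L : BooleanSubalgebra α} {s : Finset ι}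
    {f : ι → α} (h : ∀ i ∈ s, f i ∈ L) : s.inf f ∈ L :=
  Finset.inf_induction (p := fun a => a ∈ L) BooleanSubalgebra.top_mem
    (fun _ ha _ hb => BooleanSubalgebra.inf_mem ha hb) h

section Field

variable {k : Type u} [Field k] {V : Variety k}

theorem isConstructibleSet_zeroLocus {n : ℕ} (I : Ideal (MvPolynomial (Fin n) k)) :
    IsConstructibleSet (MvPolynomial.zeroLocus k I) :=
  BooleanSubalgebra.subset_closure ⟨I, rfl⟩

theorem isConstructibleSet_eval {n : ℕ} (p : MvPolynomial (Fin n) k) :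
    IsConstructibleSet {z | MvPolynomial.eval z p = 0} := by
  convert isConstructibleSet_zeroLocus (Ideal.span {p}) using 1
  ext z
  simp [MvPolynomial.zeroLocus_span, MvPolynomial.aeval_eq_eval]

theorem isConstructibleSet_fst {n m : ℕ} {A : Set (Fin n → k)} (hA : IsConstructibleSet A) :
    IsConstructibleSet {z : Fin (n + m) → k | (fun i => z (Fin.castAdd m i)) ∈ A} := by
  induction hA using BooleanSubalgebra.closure_bot_sup_induction with
  | mem Z hZ =>
    obtain ⟨I, rfl⟩ := hZ
    convert isConstructibleSet_zeroLocus (k := k)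
      (I.map (MvPolynomial.rename (Fin.castAdd m) :
        MvPolynomial (Fin n) k →ₐ[k] MvPolynomial (Fin (n + m)) k)) using 1
    ext z
    rw [Ideal.map, MvPolynomial.zeroLocus_span]
    simp [MvPolynomial.aeval_eq_eval, MvPolynomial.eval_rename, Function.comp_def]
  | bot => exact BooleanSubalgebra.bot_mem
  | sup A _ B _ ihA ihB => exact BooleanSubalgebra.sup_mem ihA ihB
  | compl A _ ihA => exact BooleanSubalgebra.compl_mem ihA

theorem isConstructible_open (W : V.X.Opens) : V.IsConstructible {x | x.1 ∈ W} := by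
  have : V.IsConstructible {x | x.1 ∈ W}ᶜ :=
    BooleanSubalgebra.subset_closure
      ((W.isOpen.preimage continuous_subtype_val).isClosed_compl)
  exact BooleanSubalgebra.compl_mem_iff.mp this

theorem isConstructible_stratum (𝒜 : V.Atlas) (j : Fin 𝒜.r) :
    V.IsConstructible (𝒜.stratum j) := by
  have h : 𝒜.stratum j = {x | x.1 ∈ 𝒜.U j} \
      {x | x.1 ∈ (⨆ l : {l : Fin 𝒜.r // l < j}, 𝒜.U l : V.X.Opens)} := by
    ext x
    simp [Variety.Atlas.stratum]
  rw [h]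
  exact BooleanSubalgebra.sdiff_mem (isConstructible_open _) (isConstructible_open _)

theorem val_empty {R : Type v} [CommRing R] (χ : EulerCharacteristic k R) {n : ℕ} : χ.val (∅ : Set (Fin n → k)) = 0 := by
  have h := χ.union (∅ : Set (Fin n → k)) ∅ BooleanSubalgebra.bot_mem BooleanSubalgebra.bot_mem
    (by simp)
  rw [Set.union_self] at h
  exact left_eq_add.mp h

theorem stratum_disjoint (𝒜 : V.Atlas) :
    Pairwise fun i j => Disjoint (𝒜.stratum i) (𝒜.stratum j) := by
  intro i j hij
  rw [Set.disjoint_left]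
  rintro x hi hj
  rcases lt_or_gt_of_ne hij with h | h
  · exact hj.2 i h hi.1
  · exact hi.2 j h hj.1

theorem iUnion_stratum (𝒜 : V.Atlas) : ⋃ j, 𝒜.stratum j = Set.univ := by
  classical
  ext x
  simp only [Set.mem_iUnion, Set.mem_univ, iff_true]
  have hne : (Finset.univ.filter fun j => x.1 ∈ 𝒜.U j).Nonempty := by
    obtain ⟨j, hj⟩ := 𝒜.cover x.1
    exact ⟨j, by simpa using hj⟩
  refine ⟨(Finset.univ.filter fun j => x.1 ∈ 𝒜.U j).min' hne, ?_, fun l hl hxl => ?_⟩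
  · simpa using Finset.min'_mem _ hne
  · exact absurd (Finset.min'_le _ l (by simpa using hxl)) (not_le.mpr hl)

theorem Variety.IsConstructible.of_eq {A B : Set V.Pt} (hB : V.IsConstructible B) (h : A = B) :
    V.IsConstructible A :=
  h ▸ hB

end Field

variable {k : Type u} [Field k] [IsAlgClosed k] {V : Variety k}

theorem Variety.value_eq_zero_iff {U : V.X.Opens} (x : V.Pt) (hx : x.1 ∈ U) (f : Γ(V.X, U)) :
    V.value x hx f = 0 ↔ x.1 ∉ V.X.basicOpen f := by
  have hi : Function.Injective (Scheme.ΓSpecIso (.of k)).hom :=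
    (ConcreteCategory.bijective_of_isIso _).1
  have h1 : V.value x hx f = 0 ↔ (V.kpoint x).appLE U ⊤ (V.le_preimage_kpoint x hx) f = 0 :=
    map_eq_zero_iff (Scheme.ΓSpecIso (.of k)).hom.hom hi
  have h2 : (V.kpoint x).appLE U ⊤ (V.le_preimage_kpoint x hx) f = 0 ↔
      (Spec (.of k)).basicOpen ((V.kpoint x).appLE U ⊤ (V.le_preimage_kpoint x hx) f) = ⊥ :=
    (basicOpen_eq_bot_iff _).symm
  rw [h1, h2, Scheme.basicOpen_appLE, top_inf_eq]
  constructor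
  · intro h hx'
    have : IsLocalRing.closedPoint k ∈ V.kpoint x ⁻¹ᵁ V.X.basicOpen f := by
      change V.kpoint x (IsLocalRing.closedPoint k) ∈ V.X.basicOpen f
      exact (pointOfClosedPoint_apply V.str x.1 x.2 (IsLocalRing.closedPoint k)).symm ▸ hx'
    rw [h] at this
    exact this
  · intro h
    ext a
    simp only [SetLike.mem_coe, Opens.coe_bot, Set.mem_empty_iff_false, iff_false]
    intro ha
    change V.kpoint x a ∈ V.X.basicOpen f at ha
    rw [Variety.kpoint, pointOfClosedPoint_apply] at ha
    exact h ha

theorem Variety.value_res {U W : V.X.Opens} (h : W ≤ U) (x : V.Pt) (hx : x.1 ∈ W)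
    (f : Γ(V.X, U)) :
    V.value x hx (V.X.presheaf.map (homOfLE h).op f) = V.value x (h hx) f := by
  unfold Variety.value
  simp only [CommRingCat.hom_comp, RingHom.comp_apply]
  congr 1
  rw [← CommRingCat.comp_apply, Scheme.Hom.map_appLE]

theorem Variety.value_of_section {U : V.X.Opens} (p : Spec (.of k) ⟶ V.X)
    (hp : p ≫ V.str = 𝟙 _)
    (x : V.Pt) (hx : x.1 ∈ U) (hpx : p (IsLocalRing.closedPoint k) = x.1)
    (hU : ⊤ ≤ p ⁻¹ᵁ U) (f : Γ(V.X, U)) :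
    V.value x hx f = (Scheme.ΓSpecIso (.of k)).hom (p.appLE U ⊤ hU f) := by
  have : p = V.kpoint x :=
    ext_of_apply_closedPoint_eq V.str hp (by simp [kpoint])
      (hpx.trans (pointOfClosedPoint_apply V.str x.1 x.2 _).symm)
  subst this
  rfl

theorem Variety.value_scalars {U : V.X.Opens} (x : V.Pt) (hx : x.1 ∈ U) (c : k) :
    V.value x hx (V.scalars U c) = c := by
  have h1 : V.str.appLE ⊤ U (show U ≤ V.str ⁻¹ᵁ ⊤ from le_top) ≫
      (V.kpoint x).appLE U ⊤ (V.le_preimage_kpoint x hx) = 𝟙 _ := by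
    rw [Scheme.Hom.appLE_comp_appLE]
    have h2 : V.kpoint x ≫ V.str = 𝟙 _ := pointOfClosedPoint_comp V.str x.1 x.2
    simp only [h2]
    rw [Scheme.Hom.appLE, Scheme.Hom.id_app]
    exact (Category.id_comp _).trans ((Spec (.of k)).presheaf.map_id _)
  have h3 : ((Scheme.ΓSpecIso (.of k)).inv ≫
      V.str.appLE ⊤ U (show U ≤ V.str ⁻¹ᵁ ⊤ from le_top)) ≫
      ((V.kpoint x).appLE U ⊤ (V.le_preimage_kpoint x hx) ≫ (Scheme.ΓSpecIso (.of k)).hom)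
      = 𝟙 _ := by
    rw [Category.assoc, reassoc_of% h1, Iso.inv_hom_id]
  exact congr($(h3).hom c)

theorem Variety.value_eval₂ {U : V.X.Opens} {d : ℕ} (c : Fin d → Γ(V.X, U)) (x : V.Pt)
    (hx : x.1 ∈ U) (p : MvPolynomial (Fin d) k) :
    V.value x hx (MvPolynomial.eval₂Hom (V.scalars U) c p) =
      MvPolynomial.eval (V.coords c x hx) p := by
  rw [← RingHom.comp_apply]
  congr 1
  apply MvPolynomial.ringHom_ext
  · intro a; simp [value_scalars]
  · intro i; simp [coords]

theorem Variety.coords_inj {U : V.X.Opens} (hU : IsAffineOpen U) {d : ℕ} (c : Fin d → Γ(V.X, U))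
    (hc : Function.Surjective (MvPolynomial.eval₂Hom (V.scalars U) c)) (x y : V.Pt)
    (hx : x.1 ∈ U) (hy : y.1 ∈ U) (h : V.coords c x hx = V.coords c y hy) : x = y := by
  by_contra hne
  obtain ⟨f, hf⟩ := hU.exists_basicOpen_le (V := ⟨({y.1} : Set V.X)ᶜ, y.2.isOpen_compl⟩)
    ⟨x.1, fun h' => hne (Subtype.ext h')⟩ hx
  obtain ⟨p, rfl⟩ := hc f
  have h1 := (Variety.value_eq_zero_iff x hx _).not.mpr (not_not.mpr hf.2)
  have h2 := (Variety.value_eq_zero_iff y hy (MvPolynomial.eval₂Hom (V.scalars U) c p)).mpr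
    (fun h' => hf.1 h' rfl)
  rw [value_eval₂] at h1 h2
  rw [h] at h1
  exact h1 h2

theorem Variety.exists_zeroLocus {U : V.X.Opens} (hU : IsAffineOpen U) {d : ℕ}
    (c : Fin d → Γ(V.X, U))
    (hc : Function.Surjective (MvPolynomial.eval₂Hom (V.scalars U) c)) (Z : Set V.Pt)
    (hZ : IsClosed Z) : ∃ I : Ideal (MvPolynomial (Fin d) k), ∀ (x : V.Pt) (hx : x.1 ∈ U),
      x ∈ Z ↔ V.coords c x hx ∈ MvPolynomial.zeroLocus k I := by
  obtain ⟨W, hW, rfl⟩ := isClosed_induced_iff.mp hZ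
  refine ⟨Ideal.span {p | ∀ x ∈ W, x ∉ V.X.basicOpen (MvPolynomial.eval₂Hom (V.scalars U) c p)},
    fun x hx => ?_⟩
  rw [MvPolynomial.zeroLocus_span]
  constructor
  · intro hxW p hp
    have := (Variety.value_eq_zero_iff x hx _).mpr (hp x.1 hxW)
    rw [value_eval₂] at this
    simpa [MvPolynomial.aeval_eq_eval] using this
  · intro h
    by_contra hxW
    obtain ⟨f, hf⟩ := hU.exists_basicOpen_le (V := ⟨Wᶜ, hW.isOpen_compl⟩) ⟨x.1, hxW⟩ hx
    obtain ⟨p, rfl⟩ := hc f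
    have h1 := (Variety.value_eq_zero_iff x hx _).not.mpr (not_not.mpr hf.2)
    rw [value_eval₂] at h1
    apply h1
    have := h p (fun y hy hy' => hf.1 hy' hy)
    simpa [MvPolynomial.aeval_eq_eval] using this

theorem Variety.exists_coords {U : V.X.Opens} (hU : IsAffineOpen U) {d : ℕ}
    (c : Fin d → Γ(V.X, U))
    (hc : Function.Surjective (MvPolynomial.eval₂Hom (V.scalars U) c)) (v : Fin d → k)
    (hv : v ∈ MvPolynomial.zeroLocus k (RingHom.ker (MvPolynomial.eval₂Hom (V.scalars U) c))) :
    ∃ (x : V.Pt) (hx : x.1 ∈ U), V.coords c x hx = v := by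
  let g : Γ(V.X, U) →+* k := RingHom.liftOfSurjective _ hc ⟨MvPolynomial.eval v, by
    intro p hp
    have := hv p hp
    simpa [MvPolynomial.aeval_eq_eval] using this⟩
  have hg : ∀ p, g (MvPolynomial.eval₂Hom (V.scalars U) c p) = MvPolynomial.eval v p := fun p =>
    RingHom.liftOfRightInverse_comp_apply _ _ _ _ _
  let p : Spec (.of k) ⟶ V.X := Spec.map (CommRingCat.ofHom g) ≫ hU.fromSpec
  have hgs : g.comp (V.scalars U) = RingHom.id k := by
    ext a
    have := hg (MvPolynomial.C a)
    simpa using this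
  have hp : p ≫ V.str = 𝟙 _ := by
    have h1 := IsAffineOpen.SpecMap_appLE_fromSpec V.str (isAffineOpen_top (Spec (.of k))) hU
      (show U ≤ V.str ⁻¹ᵁ ⊤ from le_top)
    have h2 : p ≫ V.str = Spec.map (CommRingCat.ofHom g) ≫
        Spec.map (CommRingCat.ofHom (V.scalars U)) := by
      rw [Category.assoc, ← h1, IsAffineOpen.fromSpec_top, Scheme.isoSpec_Spec_inv, ← Spec.map_comp]
      rfl
    rw [h2, ← Spec.map_comp, ← CommRingCat.ofHom_comp, hgs]
    exact Spec.map_id _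
  have hpU : ⊤ ≤ p ⁻¹ᵁ U := by
    rw [Scheme.Hom.comp_preimage, hU.fromSpec_preimage_self]
    exact le_rfl
  have hcl := (pointEquivClosedPoint V.str ⟨p, hp⟩).2
  refine ⟨⟨p (IsLocalRing.closedPoint k), hcl⟩, hpU (show IsLocalRing.closedPoint k ∈ _ from trivial), ?_⟩
  ext i
  refine (Variety.value_of_section p hp _ _ rfl hpU _).trans ?_
  have h3 : p.appLE U ⊤ hpU ≫ (Scheme.ΓSpecIso (.of k)).hom = CommRingCat.ofHom g := by
    have h5 : hU.fromSpec.appLE U ⊤ (hU.fromSpec_preimage_self.ge) =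
        (Scheme.ΓSpecIso Γ(V.X, U)).inv := by
      rw [Scheme.Hom.appLE, hU.fromSpec_app_self, Category.assoc, ← Functor.map_comp]
      exact (congrArg _ (CategoryTheory.Functor.map_id _ _)).trans (Category.comp_id _)
    have h6 := Scheme.Hom.appLE_comp_appLE (Spec.map (CommRingCat.ofHom g)) hU.fromSpec U ⊤ ⊤
      (hU.fromSpec_preimage_self.ge) le_top
    rw [← h6, h5, Category.assoc]
    have h7 : (Spec.map (CommRingCat.ofHom g)).appLE ⊤ ⊤ le_top ≫
        (Scheme.ΓSpecIso (.of k)).hom = (Scheme.ΓSpecIso Γ(V.X, U)).hom ≫ CommRingCat.ofHom g := by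
      rw [← Scheme.ΓSpecIso_naturality]
      congr 1
    rw [h7, Iso.inv_hom_id_assoc]
  have h4 : (Scheme.ΓSpecIso (.of k)).hom (p.appLE U ⊤ hpU (c i)) = g (c i) :=
    congr($(h3).hom (c i))
  rw [h4]
  have := hg (MvPolynomial.X i)
  simpa using this

theorem Variety.isConstructibleSet_chartImage {U : V.X.Opens} (hU : IsAffineOpen U) {d : ℕ}
    (c : Fin d → Γ(V.X, U)) (hc : Function.Surjective (MvPolynomial.eval₂Hom (V.scalars U) c))
    {S : Set V.Pt} (hS : V.IsConstructible S) : IsConstructibleSet (V.chartImage c S) := by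
  have hker : ∀ (x : V.Pt) (hx : x.1 ∈ U), V.coords c x hx ∈
      MvPolynomial.zeroLocus k (RingHom.ker (MvPolynomial.eval₂Hom (V.scalars U) c)) := by
    intro x hx p hp
    rw [RingHom.mem_ker] at hp
    have h := Variety.value_eval₂ c x hx p
    rw [hp, map_zero] at h
    simpa [MvPolynomial.aeval_eq_eval] using h.symm
  induction hS using BooleanSubalgebra.closure_bot_sup_induction with
  | mem Z hZ =>
    obtain ⟨I, hI⟩ := Variety.exists_zeroLocus hU c hc Z hZ
    have : V.chartImage c Z = MvPolynomial.zeroLocus k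
        (RingHom.ker (MvPolynomial.eval₂Hom (V.scalars U) c)) ⊓ MvPolynomial.zeroLocus k I := by
      ext v
      constructor
      · rintro ⟨x, hx, hxZ, rfl⟩
        exact ⟨hker x hx, (hI x hx).mp hxZ⟩
      · rintro ⟨h1, h2⟩
        obtain ⟨x, hx, rfl⟩ := Variety.exists_coords hU c hc v h1
        exact ⟨x, hx, (hI x hx).mpr h2, rfl⟩
    rw [this]
    exact BooleanSubalgebra.inf_mem (isConstructibleSet_zeroLocus _)
      (isConstructibleSet_zeroLocus _)
  | bot =>
    have : V.chartImage c ⊥ = ⊥ := by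
      ext v
      constructor
      · rintro ⟨x, hx, h, -⟩; exact h
      · intro h; exact h.elim
    rw [this]
    exact BooleanSubalgebra.bot_mem
  | sup A hA B hB ihA ihB =>
    have : V.chartImage c (A ⊔ B) = V.chartImage c A ⊔ V.chartImage c B := by
      ext v
      constructor
      · rintro ⟨x, hx, h | h, rfl⟩
        · exact Or.inl ⟨x, hx, h, rfl⟩
        · exact Or.inr ⟨x, hx, h, rfl⟩
      · rintro (⟨x, hx, h, rfl⟩ | ⟨x, hx, h, rfl⟩)
        · exact ⟨x, hx, Or.inl h, rfl⟩
        · exact ⟨x, hx, Or.inr h, rfl⟩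
    rw [this]
    exact BooleanSubalgebra.sup_mem ihA ihB
  | compl A hA ihA =>
    have : V.chartImage c Aᶜ = MvPolynomial.zeroLocus k
        (RingHom.ker (MvPolynomial.eval₂Hom (V.scalars U) c)) ⊓ (V.chartImage c A)ᶜ := by
      ext v
      constructor
      · rintro ⟨x, hx, h, rfl⟩
        refine ⟨hker x hx, ?_⟩
        rintro ⟨y, hy, hyA, hyx⟩
        exact h (Variety.coords_inj hU c hc y x hy hx hyx ▸ hyA)
      · rintro ⟨h1, h2⟩
        obtain ⟨x, hx, rfl⟩ := Variety.exists_coords hU c hc v h1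
        exact ⟨x, hx, fun hxA => h2 ⟨x, hx, hxA, rfl⟩, rfl⟩
    rw [this]
    exact BooleanSubalgebra.inf_mem (isConstructibleSet_zeroLocus _)
      (BooleanSubalgebra.compl_mem ihA)

theorem graph_chart {U U' : V.X.Opens} (hU : IsAffineOpen U) (hU' : IsAffineOpen U') {d d' : ℕ}
    (c : Fin d → Γ(V.X, U)) (hc : Function.Surjective (MvPolynomial.eval₂Hom (V.scalars U) c))
    (c' : Fin d' → Γ(V.X, U')) {T : Set V.Pt} (hT : V.IsConstructible T) :
    IsConstructibleSet {z : Fin (d + d') → k | ∃ (x : V.Pt) (hx : x.1 ∈ U) (hx' : x.1 ∈ U'),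
      x ∈ T ∧ V.coords c x hx = (fun i => z (Fin.castAdd d' i)) ∧
        V.coords c' x hx' = (fun i => z (Fin.natAdd d i))} := by
  have hqs : QuasiSeparatedSpace V.X :=
    (quasiSeparated_iff_quasiSeparatedSpace V.str).mp inferInstance
  have hcomp : IsCompact ((U : Set V.X) ∩ U') :=
    QuasiSeparatedSpace.inter_isCompact _ _ U.isOpen hU.isCompact U'.isOpen hU'.isCompact
  obtain ⟨t, ht⟩ := hcomp.elim_finite_subcover
    (ι := {f : Γ(V.X, U) // V.X.basicOpen f ≤ U'})
    (fun f => (V.X.basicOpen f.1 : Set V.X)) (fun f => (V.X.basicOpen f.1).isOpen) (by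
      rintro x ⟨hx, hx'⟩
      obtain ⟨f, hf, hxf⟩ := hU.exists_basicOpen_le (V := U') ⟨x, hx'⟩ hx
      exact Set.mem_iUnion.mpr ⟨⟨f, hf⟩, hxf⟩)
  have hloc : ∀ (f : {f : Γ(V.X, U) // V.X.basicOpen f ≤ U'}) (j : Fin d'),
      ∃ (h a : MvPolynomial (Fin d) k), ∀ (x : V.Pt) (hx : x.1 ∈ U) (hx' : x.1 ∈ U'),
        x.1 ∈ V.X.basicOpen f.1 → MvPolynomial.eval (V.coords c x hx) h ≠ 0 ∧
          MvPolynomial.eval (V.coords c x hx) h * V.coords c' x hx' j =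
            MvPolynomial.eval (V.coords c x hx) a := by
    intro f j
    have := hU.isLocalization_basicOpen f.1
    obtain ⟨⟨a, ⟨_, N, rfl⟩⟩, haN⟩ := IsLocalization.surj (Submonoid.powers f.1)
      (V.X.presheaf.map (homOfLE f.2).op (c' j))
    obtain ⟨pf, hpf⟩ := hc f.1
    obtain ⟨pa, hpa⟩ := hc a
    refine ⟨pf ^ N, pa, fun x hx hx' hxf => ?_⟩
    have h1 : V.value x hx f.1 = MvPolynomial.eval (V.coords c x hx) pf := by
      rw [← hpf, Variety.value_eval₂]
    have h2 : V.value x hx a = MvPolynomial.eval (V.coords c x hx) pa := by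
      rw [← hpa, Variety.value_eval₂]
    have h3 : ∀ g : Γ(V.X, U), V.value x hxf (algebraMap Γ(V.X, U) Γ(V.X, V.X.basicOpen f.1) g) =
        V.value x hx g := fun g => Variety.value_res (V.X.basicOpen_le f.1) x hxf g
    have h4 := congrArg (V.value x hxf) haN
    simp only [map_mul] at h4
    rw [h3, h3, Variety.value_res, map_pow, h1, h2] at h4
    refine ⟨?_, ?_⟩
    · rw [map_pow, ← h1]
      exact pow_ne_zero _ ((Variety.value_eq_zero_iff x hx _).not.mpr (not_not.mpr hxf))
    · rw [map_pow, ← h4, mul_comm]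
      rfl
  choose h a hha using hloc
  have hEq : {z : Fin (d + d') → k | ∃ (x : V.Pt) (hx : x.1 ∈ U) (hx' : x.1 ∈ U'),
      x ∈ T ∧ V.coords c x hx = (fun i => z (Fin.castAdd d' i)) ∧
        V.coords c' x hx' = (fun i => z (Fin.natAdd d i))} =
      t.sup fun f => {z | (fun i => z (Fin.castAdd d' i)) ∈
          V.chartImage c (T ∩ {x | x.1 ∈ V.X.basicOpen f.1})} ⊓
        Finset.univ.inf fun j : Fin d' => {z | MvPolynomial.eval z
          (MvPolynomial.rename (Fin.castAdd d') (h f j) * MvPolynomial.X (Fin.natAdd d j) -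
            MvPolynomial.rename (Fin.castAdd d') (a f j)) = 0} := by
    ext z
    simp only [Finset.sup_set_eq_biUnion, Finset.inf_set_eq_iInter, Set.mem_iUnion,
      Set.inf_eq_inter, Set.mem_inter_iff, Set.mem_iInter, Set.mem_ofPred_eq, map_sub, map_mul,
      MvPolynomial.eval_rename, MvPolynomial.eval_X, Function.comp_def, sub_eq_zero]
    constructor
    · rintro ⟨x, hx, hx', hxT, h1, h2⟩
      obtain ⟨f, hf⟩ := Set.mem_iUnion.mp (ht ⟨hx, hx'⟩)
      obtain ⟨hft, hxf⟩ := Set.mem_iUnion.mp hf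
      refine ⟨f, hft, ⟨x, hx, ⟨hxT, hxf⟩, h1⟩, fun j _ => ?_⟩
      have := (hha f j x hx hx' hxf).2
      rw [h1, h2] at this
      exact this
    · rintro ⟨f, hft, ⟨x, hx, ⟨hxT, hxf⟩, h1⟩, h2⟩
      have hx' : x.1 ∈ U' := f.2 hxf
      refine ⟨x, hx, hx', hxT, h1, ?_⟩
      ext j
      have h3 := hha f j x hx hx' hxf
      rw [h1] at h3
      exact mul_left_cancel₀ h3.1 (h3.2.trans (h2 j (Finset.mem_univ _)).symm)
  rw [hEq]
  refine finsetSup_mem fun f _ => BooleanSubalgebra.inf_mem ?_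
    (finsetInf_mem fun j _ => isConstructibleSet_eval _)
  exact isConstructibleSet_fst (Variety.isConstructibleSet_chartImage hU c hc
    (BooleanSubalgebra.inf_mem hT (isConstructible_open _)))

variable {R : Type v} [CommRing R] (χ : EulerCharacteristic k R)

theorem val_chartImage_eq {U U' : V.X.Opens} (hU : IsAffineOpen U) (hU' : IsAffineOpen U')
    {d d' : ℕ} (c : Fin d → Γ(V.X, U))
    (hc : Function.Surjective (MvPolynomial.eval₂Hom (V.scalars U) c)) (c' : Fin d' → Γ(V.X, U'))
    (hc' : Function.Surjective (MvPolynomial.eval₂Hom (V.scalars U') c')) {T : Set V.Pt}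
    (hT : V.IsConstructible T) (hTU : ∀ x ∈ T, x.1 ∈ U ∧ x.1 ∈ U') :
    χ.val (V.chartImage c T) = χ.val (V.chartImage c' T) := by
  classical
  let f : (Fin d → k) → (Fin d' → k) := fun v =>
    if h : ∃ (x : V.Pt) (hx : x.1 ∈ U) (_ : x.1 ∈ U'), V.coords c x hx = v then
      V.coords c' h.choose h.choose_spec.choose_spec.choose else 0
  have hf : ∀ (x : V.Pt) (hx : x.1 ∈ U) (hx' : x.1 ∈ U'),
      f (V.coords c x hx) = V.coords c' x hx' := by
    intro x hx hx'
    have h : ∃ (y : V.Pt) (hy : y.1 ∈ U) (_ : y.1 ∈ U'), V.coords c y hy = V.coords c x hx :=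
      ⟨x, hx, hx', rfl⟩
    have h1 : h.choose = x := Variety.coords_inj hU c hc _ _ _ _
      h.choose_spec.choose_spec.choose_spec
    simp only [f, dif_pos h]
    congr 1
  refine χ.bij _ _ f (Variety.isConstructibleSet_chartImage hU c hc hT)
    (Variety.isConstructibleSet_chartImage hU' c' hc' hT) ?_ ⟨?_, ?_, ?_⟩
  · convert graph_chart hU hU' c hc c' hT using 1
    ext z
    constructor
    · rintro ⟨⟨x, hx, hxT, h1⟩, h2⟩
      refine ⟨x, hx, (hTU x hxT).2, hxT, h1, ?_⟩
      rw [h2, ← h1, hf]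
    · rintro ⟨x, hx, hx', hxT, h1, h2⟩
      exact ⟨⟨x, hx, hxT, h1⟩, by rw [← h1, ← h2, hf]⟩
  · rintro _ ⟨x, hx, hxT, rfl⟩
    exact ⟨x, (hTU x hxT).2, hxT, (hf x hx _).symm⟩
  · rintro _ ⟨x, hx, hxT, rfl⟩ _ ⟨y, hy, hyT, rfl⟩ h
    rw [hf x hx (hTU x hxT).2, hf y hy (hTU y hyT).2] at h
    have := Variety.coords_inj hU' c' hc' _ _ _ _ h
    subst this
    rfl
  · rintro _ ⟨x, hx', hxT, rfl⟩
    exact ⟨_, ⟨x, (hTU x hxT).1, hxT, rfl⟩, hf _ _ _⟩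

theorem val_chartImage_union {U : V.X.Opens} (hU : IsAffineOpen U) {d : ℕ} (c : Fin d → Γ(V.X, U))
    (hc : Function.Surjective (MvPolynomial.eval₂Hom (V.scalars U) c)) {A B : Set V.Pt}
    (hA : V.IsConstructible A) (hB : V.IsConstructible B) (hAB : Disjoint A B) :
    χ.val (V.chartImage c (A ∪ B)) = χ.val (V.chartImage c A) + χ.val (V.chartImage c B) := by
  rw [← χ.union _ _ (Variety.isConstructibleSet_chartImage hU c hc hA)
    (Variety.isConstructibleSet_chartImage hU c hc hB)]
  · congr 1
    ext v
    constructor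
    · rintro ⟨x, hx, h | h, rfl⟩
      · exact Or.inl ⟨x, hx, h, rfl⟩
      · exact Or.inr ⟨x, hx, h, rfl⟩
    · rintro (⟨x, hx, h, rfl⟩ | ⟨x, hx, h, rfl⟩)
      · exact ⟨x, hx, Or.inl h, rfl⟩
      · exact ⟨x, hx, Or.inr h, rfl⟩
  · rw [Set.disjoint_left]
    rintro _ ⟨x, hx, hxA, rfl⟩ ⟨y, hy, hyB, hyx⟩
    have := Variety.coords_inj hU c hc _ _ _ _ hyx
    subst this
    exact Set.disjoint_left.mp hAB hxA hyB

theorem val_chartImage_biUnion {U : V.X.Opens} (hU : IsAffineOpen U) {d : ℕ}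
    (c : Fin d → Γ(V.X, U)) (hc : Function.Surjective (MvPolynomial.eval₂Hom (V.scalars U) c))
    {ι : Type*} (s : Finset ι) (A : ι → Set V.Pt) (hA : ∀ i, V.IsConstructible (A i))
    (hd : Pairwise fun i j => Disjoint (A i) (A j)) :
    χ.val (V.chartImage c (⋃ i ∈ s, A i)) = ∑ i ∈ s, χ.val (V.chartImage c (A i)) := by
  classical
  induction s using Finset.induction_on with
  | empty =>
    have : V.chartImage c (⋃ i ∈ (∅ : Finset ι), A i) = ∅ := by
      ext v; simp [Variety.chartImage]
    rw [this, val_empty, Finset.sum_empty]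
  | insert i s his ih =>
    rw [Finset.sum_insert his, ← ih, Finset.set_biUnion_insert,
      val_chartImage_union χ hU c hc (hA i)]
    · rw [← Finset.sup_set_eq_biUnion]
      exact finsetSup_mem fun j _ => hA j
    · rw [Set.disjoint_iUnion₂_right]
      intro j hj
      exact hd (fun h => his (h ▸ hj))

/-- The value does not depend on the atlas. -/
theorem EulerCharacteristic.inAtlas_eq (𝒜 ℬ : V.Atlas) {S : Set V.Pt} (hS : V.IsConstructible S) :
    χ.inAtlas 𝒜 S = χ.inAtlas ℬ S := by
  have key : ∀ (𝒜 ℬ : V.Atlas), χ.inAtlas 𝒜 S = ∑ j, ∑ l,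
      χ.val (V.chartImage (𝒜.coord j) (S ∩ 𝒜.stratum j ∩ ℬ.stratum l)) := by
    intro 𝒜 ℬ
    refine Finset.sum_congr rfl fun j _ => ?_
    rw [← val_chartImage_biUnion χ (𝒜.affine j) (𝒜.coord j) (𝒜.surj j) Finset.univ
      (fun l => S ∩ 𝒜.stratum j ∩ ℬ.stratum l)]
    · congr 2
      simp only [Finset.mem_univ, Set.iUnion_true]
      rw [← Set.inter_iUnion, iUnion_stratum, Set.inter_univ]
    · exact fun l => BooleanSubalgebra.inf_mem
        (BooleanSubalgebra.inf_mem hS (isConstructible_stratum 𝒜 j)) (isConstructible_stratum ℬ l)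
    · exact fun l l' hl => (stratum_disjoint ℬ hl).mono Set.inter_subset_right
        Set.inter_subset_right
  rw [key 𝒜 ℬ, key ℬ 𝒜, Finset.sum_comm]
  refine Finset.sum_congr rfl fun l _ => Finset.sum_congr rfl fun j _ => ?_
  rw [Set.inter_right_comm S (ℬ.stratum l)]
  refine val_chartImage_eq χ (𝒜.affine j) (ℬ.affine l) _ (𝒜.surj j) _ (ℬ.surj l) ?_ ?_
  · exact BooleanSubalgebra.inf_mem
      (BooleanSubalgebra.inf_mem hS (isConstructible_stratum 𝒜 j)) (isConstructible_stratum ℬ l)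
  · rintro x ⟨⟨-, h1⟩, h2⟩
    exact ⟨h1.1, h2.1⟩

theorem EulerCharacteristic.ofVariety_union {A B : Set V.Pt} (hA : V.IsConstructible A)
    (hB : V.IsConstructible B) (hAB : Disjoint A B) :
    χ.ofVariety V (A ∪ B) = χ.ofVariety V A + χ.ofVariety V B := by
  unfold ofVariety inAtlas
  rw [← Finset.sum_add_distrib]
  refine Finset.sum_congr rfl fun j _ => ?_
  rw [Set.union_inter_distrib_right]
  exact val_chartImage_union χ (Variety.Atlas.affine _ j) _ (Variety.Atlas.surj _ j)
    (BooleanSubalgebra.inf_mem hA (isConstructible_stratum _ j))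
    (BooleanSubalgebra.inf_mem hB (isConstructible_stratum _ j))
    (hAB.mono Set.inter_subset_left Set.inter_subset_left)

/-- The extension is computed by any closed embedding of an affine open subset in affine space. -/
theorem EulerCharacteristic.ofVariety_eq_val {U : V.X.Opens} (hU : IsAffineOpen U) {d : ℕ}
    (c : Fin d → Γ(V.X, U)) (hc : Function.Surjective (MvPolynomial.eval₂Hom (V.scalars U) c))
    {S : Set V.Pt} (hS : V.IsConstructible S) (hSU : ∀ x ∈ S, x.1 ∈ U) :
    χ.ofVariety V S = χ.val (V.chartImage c S) := by
  set 𝒜 : V.Atlas := Classical.choice V.nonempty_atlas with h𝒜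
  have h1 : S = ⋃ j ∈ (Finset.univ : Finset (Fin 𝒜.r)), S ∩ 𝒜.stratum j := by
    simp only [Finset.mem_univ, Set.iUnion_true]
    rw [← Set.inter_iUnion, iUnion_stratum, Set.inter_univ]
  conv_rhs => rw [h1]
  rw [val_chartImage_biUnion χ hU c hc]
  · change ∑ j : Fin 𝒜.r, _ = _
    refine Finset.sum_congr rfl fun j _ => ?_
    refine val_chartImage_eq χ (𝒜.affine j) hU _ (𝒜.surj j) _ hc
      (BooleanSubalgebra.inf_mem hS (isConstructible_stratum 𝒜 j)) ?_
    rintro x ⟨h2, h3⟩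
    exact ⟨h3.1, hSU x h2⟩
  · exact fun j => BooleanSubalgebra.inf_mem hS (isConstructible_stratum 𝒜 j)
  · exact fun l l' hl => (stratum_disjoint 𝒜 hl).mono Set.inter_subset_right Set.inter_subset_right

end WellDefined

/-! ### Integration -/

/-- The integrable functions on `V`: the `R`-span of the characteristic functions of
constructible sets. -/
def Variety.integrable {k : Type u} [Field k] (V : Variety k) (R : Type v) [CommRing R] :
    Submodule R (V.Pt → R) :=
  Submodule.span R {f | ∃ S : Set V.Pt, V.IsConstructible S ∧ f = S.indicator 1}

/-- The integral `∫ f dχ` of an integrable function: such an `f` takes finitely many values, on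
constructible sets, and `∫ f dχ = ∑ r · χ({f = r})`. It is linear on integrable functions and
`∫ 1_S dχ = χ(S)`, see `integral_add`, `integral_smul` and `integral_indicator`. -/
def EulerCharacteristic.integral {k : Type u} [Field k] [IsAlgClosed k] {R : Type v} [CommRing R]
    (χ : EulerCharacteristic k R) (V : Variety k) (f : V.Pt → R) : R :=
  ∑ᶠ r : R, r * χ.ofVariety V (f ⁻¹' {r})

section IntegralLemmas

variable {k : Type u} [Field k] [IsAlgClosed k] {V : Variety k} {R : Type v} [CommRing R]
  (χ : EulerCharacteristic k R)

theorem EulerCharacteristic.ofVariety_empty : χ.ofVariety V ∅ = 0 := by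
  have h := χ.ofVariety_union (V := V) (A := ∅) (B := ∅) BooleanSubalgebra.bot_mem
    BooleanSubalgebra.bot_mem (by simp)
  rw [Set.union_self] at h
  exact left_eq_add.mp h

theorem EulerCharacteristic.ofVariety_biUnion {ι : Type*} (s : Finset ι) (A : ι → Set V.Pt)
    (hA : ∀ i, V.IsConstructible (A i)) (hd : Pairwise fun i j => Disjoint (A i) (A j)) :
    χ.ofVariety V (⋃ i ∈ s, A i) = ∑ i ∈ s, χ.ofVariety V (A i) := by
  classical
  induction s using Finset.induction_on with
  | empty => simp [χ.ofVariety_empty]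
  | insert i s his ih =>
    rw [Finset.sum_insert his, ← ih, Finset.set_biUnion_insert, χ.ofVariety_union (hA i)]
    · rw [← Finset.sup_set_eq_biUnion]
      exact finsetSup_mem fun j _ => hA j
    · rw [Set.disjoint_iUnion₂_right]
      intro j hj
      exact hd (fun h => his (h ▸ hj))

theorem EulerCharacteristic.integral_comp {ι : Type*} (h : V.Pt → ι) (T : Finset ι)
    (hT : ∀ x, h x ∈ T) (hh : ∀ i, V.IsConstructible (h ⁻¹' {i})) (F : ι → R) :
    χ.integral V (fun x => F (h x)) = ∑ i ∈ T, F i * χ.ofVariety V (h ⁻¹' {i}) := by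
  classical
  have hpre : ∀ r, (fun x => F (h x)) ⁻¹' {r} = ⋃ i ∈ T.filter (fun i => F i = r), h ⁻¹' {i} := by
    intro r
    ext x
    simp [hT]
  have hval : ∀ r, χ.ofVariety V ((fun x => F (h x)) ⁻¹' {r}) =
      ∑ i ∈ T.filter (fun i => F i = r), χ.ofVariety V (h ⁻¹' {i}) := by
    intro r
    rw [hpre r]
    refine χ.ofVariety_biUnion _ _ hh fun i j hij => ?_
    exact Disjoint.preimage h (by simpa using hij)
  unfold integral
  rw [finsum_eq_sum_of_support_subset (s := T.image F)]
  · rw [← Finset.sum_fiberwise_of_maps_to (s := T) (t := T.image F) (g := F)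
      (fun i hi => Finset.mem_image_of_mem F hi)]
    refine Finset.sum_congr rfl fun r _ => ?_
    rw [hval r, Finset.mul_sum]
    refine Finset.sum_congr rfl fun i hi => ?_
    rw [(Finset.mem_filter.mp hi).2]
  · intro r hr
    by_contra hr'
    apply hr
    have : T.filter (fun i => F i = r) = ∅ := by
      ext i
      simp only [Finset.mem_filter, Finset.notMem_empty, iff_false, not_and]
      rintro hi rfl
      exact hr' (by simpa using ⟨i, hi, rfl⟩)
    simp only [hval r, this, Finset.sum_empty, mul_zero]

theorem Variety.integrable_simple {f : V.Pt → R} (hf : f ∈ V.integrable R) :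
    (∃ T : Finset R, ∀ x, f x ∈ T) ∧ ∀ r, V.IsConstructible (f ⁻¹' {r}) := by
  classical
  have hpair : ∀ {f g : V.Pt → R} (T T' : Finset R), (∀ x, f x ∈ T) → (∀ x, g x ∈ T') →
      (∀ r, V.IsConstructible (f ⁻¹' {r})) → (∀ r, V.IsConstructible (g ⁻¹' {r})) →
      ∀ r, V.IsConstructible ((f + g) ⁻¹' {r}) := by
    intro f g T T' hT hT' hf hg r
    have : (f + g) ⁻¹' {r} = ((T ×ˢ T').filter fun p => p.1 + p.2 = r).sup
        fun p => f ⁻¹' {p.1} ⊓ g ⁻¹' {p.2} := by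
      ext x
      simp [hT, hT', Finset.sup_set_eq_biUnion]
    rw [this]
    exact finsetSup_mem fun p _ => BooleanSubalgebra.inf_mem (hf _) (hg _)
  induction hf using Submodule.span_induction with
  | mem f hf =>
    obtain ⟨S, hS, rfl⟩ := hf
    refine ⟨⟨{0, 1}, fun x => ?_⟩, fun r => ?_⟩
    · by_cases hx : x ∈ S <;> simp [hx]
    · by_cases h0 : (0 : R) = r <;> by_cases h1 : (1 : R) = r
      · refine Variety.IsConstructible.of_eq (BooleanSubalgebra.top_mem : V.IsConstructible ⊤) ?_
        ext x; by_cases hx : x ∈ S <;> simp [hx, h0, h1]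
      · refine Variety.IsConstructible.of_eq (BooleanSubalgebra.compl_mem hS) ?_
        ext x; by_cases hx : x ∈ S <;> simp [hx, h0, h1]
      · refine Variety.IsConstructible.of_eq hS ?_
        ext x; by_cases hx : x ∈ S <;> simp [hx, h0, h1]
      · refine Variety.IsConstructible.of_eq (BooleanSubalgebra.bot_mem : V.IsConstructible ⊥) ?_
        ext x; by_cases hx : x ∈ S <;> simp [hx, h0, h1]
  | zero =>
    refine ⟨⟨{0}, by simp⟩, fun r => ?_⟩
    by_cases h0 : (0 : R) = r
    · refine Variety.IsConstructible.of_eq (BooleanSubalgebra.top_mem : V.IsConstructible ⊤) ?_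
      ext x; simp [h0]
    · refine Variety.IsConstructible.of_eq (BooleanSubalgebra.bot_mem : V.IsConstructible ⊥) ?_
      ext x; simp [h0]
  | add f g _ _ ihf ihg =>
    obtain ⟨⟨T, hT⟩, hf⟩ := ihf
    obtain ⟨⟨T', hT'⟩, hg⟩ := ihg
    exact ⟨⟨(T ×ˢ T').image fun p => p.1 + p.2, fun x =>
      Finset.mem_image.mpr ⟨(f x, g x), by simp [hT, hT'], rfl⟩⟩, hpair T T' hT hT' hf hg⟩
  | smul c f _ ih =>
    obtain ⟨⟨T, hT⟩, hf⟩ := ih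
    refine ⟨⟨T.image (c * ·), fun x => Finset.mem_image.mpr ⟨f x, hT x, rfl⟩⟩, fun r => ?_⟩
    have : (c • f) ⁻¹' {r} = (T.filter fun s => c * s = r).sup fun s => f ⁻¹' {s} := by
      ext x
      simp [hT, Finset.sup_set_eq_biUnion]
    rw [this]
    exact finsetSup_mem fun s _ => hf s

theorem EulerCharacteristic.integral_indicator {S : Set V.Pt} (hS : V.IsConstructible S) :
    χ.integral V (S.indicator 1) = χ.ofVariety V S := by
  classical
  have h := χ.integral_comp (fun x => decide (x ∈ S)) Finset.univ
    (fun _ => Finset.mem_univ _) (by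
    rintro (_ | _)
    · refine Variety.IsConstructible.of_eq (BooleanSubalgebra.compl_mem hS) ?_
      ext x; simp
    · refine Variety.IsConstructible.of_eq hS ?_
      ext x; simp) (fun b => if b then (1 : R) else 0)
  have h1 : (fun x => if decide (x ∈ S) = true then (1 : R) else 0) = S.indicator 1 := by
    ext x; by_cases hx : x ∈ S <;> simp [hx]
  have h2 : (fun x => decide (x ∈ S)) ⁻¹' {true} = S := by
    ext x; simp
  rw [h1] at h
  simpa [h2] using h

theorem EulerCharacteristic.integral_add {f g : V.Pt → R} (hf : f ∈ V.integrable R)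
    (hg : g ∈ V.integrable R) :
    χ.integral V (f + g) = χ.integral V f + χ.integral V g := by
  obtain ⟨⟨T, hT⟩, hf⟩ := Variety.integrable_simple hf
  obtain ⟨⟨T', hT'⟩, hg⟩ := Variety.integrable_simple hg
  have key := χ.integral_comp (fun x => (f x, g x)) (T ×ˢ T') (by simp [hT, hT']) (by
    rintro ⟨r, s⟩
    refine Variety.IsConstructible.of_eq (BooleanSubalgebra.inf_mem (hf r) (hg s)) ?_
    ext x; simp)
  have h1 := key fun p => p.1 + p.2
  have h2 := key fun p => p.1
  have h3 := key fun p => p.2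
  simp only [add_mul, Finset.sum_add_distrib] at h1
  rw [← h2, ← h3] at h1
  exact h1

theorem EulerCharacteristic.integral_smul (c : R) {f : V.Pt → R} (hf : f ∈ V.integrable R) :
    χ.integral V (c • f) = c * χ.integral V f := by
  obtain ⟨⟨T, hT⟩, hf⟩ := Variety.integrable_simple hf
  have key := χ.integral_comp f T hT hf
  have h1 := key fun r => c * r
  have h2 := key fun r => r
  simp only [mul_assoc] at h1
  rw [← Finset.mul_sum, ← h2] at h1
  exact h1

end IntegralLemmas

/-! ### Morphisms -/

theorem map_genericPoint {X Y : Scheme.{u}} [IrreducibleSpace X] [IrreducibleSpace Y] (φ : X ⟶ Y)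
    [IsDominant φ] : φ (genericPoint X) = genericPoint Y := by
  apply ((genericPoint_spec Y).eq _).symm
  have h := (genericPoint_spec X).image φ.continuous
  rwa [Set.image_univ, φ.denseRange.closure_range] at h

/-- The inclusion of function fields `K(Y) → K(X)` induced by a dominant morphism. -/
def functionFieldMap {X Y : Scheme.{u}} [IrreducibleSpace X] [IrreducibleSpace Y] (φ : X ⟶ Y)
    [IsDominant φ] : Y.functionField →+* X.functionField :=
  (Y.presheaf.stalkSpecializes (specializes_of_eq (map_genericPoint φ)) ≫
    φ.stalkMap (genericPoint X)).hom

/-- A dominant morphism is separable if the extension of function fields `K(X) / K(Y)` is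
(algebraic and) separable. -/
def IsSeparableMorphism {X Y : Scheme.{u}} [IsIntegral X] [IsIntegral Y] (φ : X ⟶ Y)
    [IsDominant φ] : Prop :=
  letI := (functionFieldMap φ).toAlgebra
  Algebra.IsSeparable Y.functionField X.functionField

/-- The degree `[K(X) : K(Y)]` of a dominant morphism. -/
def degree {X Y : Scheme.{u}} [IsIntegral X] [IsIntegral Y] (φ : X ⟶ Y) [IsDominant φ] : ℕ :=
  letI := (functionFieldMap φ).toAlgebra
  Module.finrank Y.functionField X.functionField

/-- The ramification index `e_x(φ)` of the extension of local rings `𝒪_{Y, φ(x)} → 𝒪_{X, x}`. -/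
def ramificationIndex {X Y : Scheme.{u}} (φ : X ⟶ Y) (x : X) : ℕ :=
  letI := (φ.stalkMap x).hom.toAlgebra
  (IsLocalRing.maximalIdeal (X.presheaf.stalk x)).ramificationIdx (Y.presheaf.stalk (φ x))

/-- The fibre of `φ` over a closed point, as a set of closed points. -/
def fibre {k : Type u} [Field k] {V W : Variety k} (φ : V.X ⟶ W.X) (y : W.Pt) : Set V.Pt :=
  {x | φ x.1 = y.1}

/-- Fubini's theorem holds for `φ : V ⟶ W`: all fibres over closed points are constructible, the
function `y ↦ χ(φ⁻¹(y))` is integrable on `W`, and `χ(V) = ∫_W χ(φ⁻¹(y)) dχ(y)`. -/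
structure FubiniHolds {k : Type u} [Field k] [IsAlgClosed k] {R : Type v} [CommRing R]
    (χ : EulerCharacteristic k R) {V W : Variety k} (φ : V.X ⟶ W.X) : Prop where
  fibre_constructible : ∀ y : W.Pt, V.IsConstructible (fibre φ y)
  integrable : (fun y => χ.ofVariety V (fibre φ y)) ∈ W.integrable R
  eq_integral : χ.ofVariety V Set.univ = χ.integral W (fun y => χ.ofVariety V (fibre φ y))

end EulerFubini

end

/-!
Only the fibres of `φ` matter, and these are finite: an Euler characteristic takes the value one on
every point, so its value on a finite set of closed points is the number of elements
(`EulerCharacteristic.ofVariety_finite`). The claim therefore reduces to counting points in fibres.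

The morphism `φ` is finite and flat. The curves are étale over the affine line locally, so their
coordinate rings are Dedekind domains (`ProjectiveCurve.isDedekindDomain`) and their local rings are
principal ideal domains; flatness is then torsion-freeness (`ProjectiveCurve.flat`). Closed sets
without the generic point are finite and only the generic point lies over the generic point, so the
fibres of `φ` are finite. As `φ` is proper, it is finite by Zariski's main theorem
(`ProjectiveCurve.isFinite`). Hence, for affine `U`, the algebra `Γ(C₁, φ⁻¹U)` has constant rank
`deg φ` over `Γ(C₂, U)`, and since all residue fields at closed points are `k`, the formula
`∑ e f = n` becomes `∑_{φ(x) = y} e_x = deg φ` for every closed point `y`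
(`sum_ramificationIndex_fibre`).

A separable extension of function fields is unramified, so `φ` is unramified near the generic point,
and the complement of such a neighbourhood is finite (`finite_ramificationIndex_ne_one`). Now
`χ(φ⁻¹(y)) = deg φ - ∑_{φ(x) = y} (e_x - 1)` (`ofVariety_fibre`), a constant plus a finitely
supported function of `y`. It is integrable, with integral `χ(C₂) deg φ - ∑_x (e_x - 1)`
(`EulerCharacteristic.integral_const`, `integral_sum_fibre`), and Fubini's theorem says that this
integral is `χ(C₁)`.
-/

noncomputable section

namespace EulerFubini

/-! ### Euler characteristics of finite sets and of finite perturbations of constants -/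

section FiniteSets

variable {k : Type u} [Field k] {R : Type v} [CommRing R]

/-- Every point of `kⁿ` has Euler characteristic one: it is in constructible bijection with the
point of `k⁰`, where the value is prescribed. -/
theorem EulerCharacteristic.val_singleton (χ : EulerCharacteristic k R) {n : ℕ} (p : Fin n → k) :
    χ.val {p} = 1 := by
  have hp : IsConstructibleSet ({p} : Set (Fin n → k)) := by
    have : ({p} : Set (Fin n → k)) = Finset.univ.inf fun i : Fin n =>
        {z | MvPolynomial.eval z (MvPolynomial.X i - MvPolynomial.C (p i)) = 0} := by
      ext z
      simp [Finset.inf_set_eq_iInter, sub_eq_zero, funext_iff]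
    rw [this]
    exact finsetInf_mem fun i _ => isConstructibleSet_eval _
  rw [← χ.point]
  refine (χ.bij ⊤ _ (fun _ => p) BooleanSubalgebra.top_mem hp ?_ ?_).symm
  · have : graphOn (⊤ : Set (Fin 0 → k)) (fun _ => p) = Finset.univ.inf fun i : Fin n =>
        {z | MvPolynomial.eval z (MvPolynomial.X (Fin.natAdd 0 i) - MvPolynomial.C (p i)) = 0} := by
      ext z
      simp [graphOn, Finset.inf_set_eq_iInter, sub_eq_zero, funext_iff]
    rw [this]
    exact finsetInf_mem fun i _ => isConstructibleSet_eval _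
  · exact ⟨fun _ _ => rfl, fun _ _ _ _ _ => Subsingleton.elim _ _,
      fun q hq => ⟨0, trivial, hq.symm⟩⟩

variable {V : Variety k}

theorem Variety.isClosed_singleton (x : V.Pt) : IsClosed ({x} : Set V.Pt) := by
  have : ({x} : Set V.Pt) = Subtype.val ⁻¹' {x.1} := by
    ext y
    simp [Subtype.ext_iff]
  rw [this]
  exact x.2.preimage continuous_subtype_val

theorem Variety.isConstructible_singleton (x : V.Pt) : V.IsConstructible {x} :=
  BooleanSubalgebra.subset_closure (Variety.isClosed_singleton x)

theorem Variety.isConstructible_finite {S : Set V.Pt} (hS : S.Finite) : V.IsConstructible S := by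
  have : S = hS.toFinset.sup fun x => {x} := by
    ext y
    simp [Finset.sup_set_eq_biUnion]
  rw [this]
  exact finsetSup_mem fun x _ => Variety.isConstructible_singleton x

variable [IsAlgClosed k] (χ : EulerCharacteristic k R)

theorem EulerCharacteristic.ofVariety_singleton (x : V.Pt) : χ.ofVariety V {x} = 1 := by
  obtain ⟨𝒜⟩ := V.nonempty_atlas
  obtain ⟨j, hj⟩ := 𝒜.cover x.1
  rw [χ.ofVariety_eq_val (𝒜.affine j) (𝒜.coord j) (𝒜.surj j)
    (Variety.isConstructible_singleton x) (by rintro _ rfl; exact hj)]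
  have : V.chartImage (𝒜.coord j) {x} = {V.coords (𝒜.coord j) x hj} := by
    ext p
    constructor
    · rintro ⟨_, h, rfl, rfl⟩
      rfl
    · rintro rfl
      exact ⟨x, hj, rfl, rfl⟩
  rw [this, χ.val_singleton]

/-- The Euler characteristic of a finite set of closed points is its number of elements. -/
theorem EulerCharacteristic.ofVariety_finite {S : Set V.Pt} (hS : S.Finite) :
    χ.ofVariety V S = (S.ncard : R) := by
  have h := χ.ofVariety_biUnion hS.toFinset (fun x : V.Pt => {x})
    (fun x => Variety.isConstructible_singleton x) (fun x y hxy => by simpa using hxy)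
  simp only [Set.Finite.mem_toFinset, Set.biUnion_of_singleton, χ.ofVariety_singleton,
    Finset.sum_const, nsmul_eq_mul, mul_one] at h
  rw [h, Set.ncard_eq_toFinset_card S hS]

theorem EulerCharacteristic.integral_const (c : R) :
    (fun _ : V.Pt => c) ∈ V.integrable R ∧
      χ.integral V (fun _ => c) = χ.ofVariety V Set.univ * c := by
  have h1 : (Set.univ : Set V.Pt).indicator (1 : V.Pt → R) ∈ V.integrable R :=
    Submodule.subset_span ⟨_, BooleanSubalgebra.top_mem, rfl⟩
  have h2 : (fun _ : V.Pt => c) = c • (Set.univ : Set V.Pt).indicator (1 : V.Pt → R) := by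
    ext x
    simp
  rw [h2]
  exact ⟨Submodule.smul_mem _ _ h1, by
    rw [χ.integral_smul c h1, mul_comm, χ.integral_indicator
      (show V.IsConstructible Set.univ from BooleanSubalgebra.top_mem)]⟩

/-- A finitely supported function is integrable, and its integral is the sum of its values. -/
theorem EulerCharacteristic.integral_of_finite_support (g : V.Pt → R)
    (hg : (Function.support g).Finite) :
    g ∈ V.integrable R ∧ χ.integral V g = ∑ᶠ x, g x := by
  classical
  have key : ∀ s : Finset V.Pt, (∑ x ∈ s, g x • ({x} : Set V.Pt).indicator 1) ∈ V.integrable R ∧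
      χ.integral V (∑ x ∈ s, g x • ({x} : Set V.Pt).indicator 1) = ∑ x ∈ s, g x := by
    intro s
    induction s using Finset.induction_on with
    | empty =>
      have h := χ.integral_const (V := V) 0
      rw [mul_zero] at h
      exact h
    | insert x s hx ih =>
      have h1 : ({x} : Set V.Pt).indicator (1 : V.Pt → R) ∈ V.integrable R :=
        Submodule.subset_span ⟨_, Variety.isConstructible_singleton x, rfl⟩
      simp only [Finset.sum_insert hx]
      refine ⟨Submodule.add_mem _ (Submodule.smul_mem _ _ h1) ih.1, ?_⟩
      rw [χ.integral_add (Submodule.smul_mem _ _ h1) ih.1, χ.integral_smul _ h1, ih.2,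
        χ.integral_indicator (Variety.isConstructible_singleton x), χ.ofVariety_singleton, mul_one]
  have hsum : g = ∑ x ∈ hg.toFinset, g x • ({x} : Set V.Pt).indicator (1 : V.Pt → R) := by
    ext y
    simp only [Finset.sum_apply, Pi.smul_apply, Set.indicator_apply, Set.mem_singleton_iff,
      Pi.one_apply, smul_eq_mul, mul_ite, mul_one, mul_zero]
    rw [Finset.sum_ite_eq]
    simp
  rw [finsum_eq_sum _ hg]
  conv_lhs => rw [hsum]
  have h2 := (key hg.toFinset).2
  rw [← hsum] at h2
  exact ⟨(key hg.toFinset).1, h2⟩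

end FiniteSets

/-! ### Standard smooth algebras of relative dimension one -/

section Dedekind

/-- Let `p` be the prime of `A` under `q`. Unramifiedness says that `q B_q` is generated by `p`,
hence by one element, and a Noetherian local domain with principal maximal ideal is a principal
ideal domain. -/
theorem isPrincipalIdealRing_localization_of_formallyUnramified (A : Type*) {B : Type*}
    [CommRing A] [CommRing B] [IsPrincipalIdealRing A] [IsNoetherianRing B] [IsDomain B]
    [Algebra A B] [Algebra.EssFiniteType A B] [Algebra.FormallyUnramified A B]
    (q : Ideal B) [q.IsPrime] : IsPrincipalIdealRing (Localization.AtPrime q) := by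
  let := Localization.AtPrime.algebraOfLiesOver (q.under A) q
  have h := ((Algebra.isUnramifiedAt_iff_map_eq A (q.under A) q).mp inferInstance).2
  have : IsNoetherianRing (Localization.AtPrime q) :=
    IsLocalization.isNoetherianRing q.primeCompl _ inferInstance
  -- It suffices that the maximal ideal is principal.
  refine ((tfae_of_isNoetherianRing_of_isLocalRing_of_isDomain
    (Localization.AtPrime q)).out 4 0).mp ?_
  rw [← h]
  infer_instance

theorem isDedekindDomain_of_isPrincipalIdealRing_localization {B : Type*} [CommRing B]
    [IsNoetherianRing B] [IsDomain B]
    (h : ∀ (q : Ideal B) [q.IsPrime], IsPrincipalIdealRing (Localization.AtPrime q)) :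
    IsDedekindDomain B := by
  have : IsDedekindDomainDvr B :=
    { is_dvr_at_nonzero_prime := fun q hq hqp =>
        have := h q
        { not_a_field' := fun h0 => IsLocalization.AtPrime.not_isField B hq
            (Localization.AtPrime q) (IsLocalRing.isField_iff_maximalIdeal_eq.mpr h0) } }
  infer_instance

/-- A standard smooth algebra of relative dimension one over a field `K` is étale over a polynomial
ring in one variable, which is a principal ideal domain. -/
theorem isDedekindDomain_of_isStandardSmoothOfRelativeDimension_one {K B : Type*} [CommRing K]
    [CommRing B] [IsDomain B] (hK : IsField K) {f : K →+* B}
    (hf : f.IsStandardSmoothOfRelativeDimension 1) : IsDedekindDomain B := by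
  let := hK.toField
  obtain ⟨g, -, hg⟩ := hf.exists_etale_mvPolynomial
  algebraize [g]
  have : IsPrincipalIdealRing (MvPolynomial (Fin 1) K) :=
    IsPrincipalIdealRing.of_surjective (MvPolynomial.uniqueAlgEquiv K (Fin 1)).symm
      (MvPolynomial.uniqueAlgEquiv K (Fin 1)).symm.surjective
  have : IsNoetherianRing B :=
    Algebra.FiniteType.isNoetherianRing (MvPolynomial (Fin 1) K) B
  exact isDedekindDomain_of_isPrincipalIdealRing_localization fun q _ =>
    isPrincipalIdealRing_localization_of_formallyUnramified (MvPolynomial (Fin 1) K) q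

end Dedekind

/-! ### Ramification indices -/

section Ramification

theorem ramificationIdx_eq_one_of_isLocalization {A S : Type*} [CommRing A] [CommRing S]
    [Algebra A S] (M : Submonoid A) [IsLocalization M S] (q : Ideal S) [q.IsPrime] :
    q.ramificationIdx A = 1 := by
  have : Algebra.FormallyUnramified A S := Algebra.FormallyUnramified.of_isLocalization M
  have : Algebra.EssFiniteType A S := Algebra.EssFiniteType.of_isLocalization S M
  exact Ideal.ramificationIdx_eq_one q A

/-- Ramification indices can be computed after localization. Both sides are the ramification index
of the maximal ideal of `T` over `A`, by multiplicativity in the towers `A → B → T` and `A → S → T`,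
as localizations are unramified. -/
theorem ramificationIdx_localization {A B S T : Type*} [CommRing A] [CommRing B] [CommRing S]
    [CommRing T] [Algebra A B] [Algebra A S] [Algebra A T] [Algebra B T] [Algebra S T]
    [IsScalarTower A B T] [IsScalarTower A S T] (p : Ideal A) (q : Ideal B) [p.IsPrime]
    [q.IsPrime] [IsLocalRing S] [IsLocalRing T] [IsLocalization.AtPrime S p]
    [IsLocalization.AtPrime T q] [Module.Flat S T] [q.LiesOver p] [IsLocalHom (algebraMap S T)] :
    (IsLocalRing.maximalIdeal T).ramificationIdx S = q.ramificationIdx A := by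
  have : Module.Flat B T := IsLocalization.flat T q.primeCompl
  have : (IsLocalRing.maximalIdeal T).LiesOver q :=
    ⟨(IsLocalization.AtPrime.under_maximalIdeal T q).symm⟩
  have : (IsLocalRing.maximalIdeal T).LiesOver (IsLocalRing.maximalIdeal S) :=
    ⟨((IsLocalRing.local_hom_TFAE (algebraMap S T)).out 0 4 rfl rfl).mp inferInstance |>.symm⟩
  have h1 := Ideal.ramificationIdx_tower (R := A) q (IsLocalRing.maximalIdeal T)
  have h2 := Ideal.ramificationIdx_tower (R := A) (IsLocalRing.maximalIdeal S)
    (IsLocalRing.maximalIdeal T)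
  rw [ramificationIdx_eq_one_of_isLocalization q.primeCompl, mul_one] at h1
  rw [ramificationIdx_eq_one_of_isLocalization p.primeCompl (IsLocalRing.maximalIdeal S),
    one_mul] at h2
  rw [← h2, h1]

/-- Over an algebraically closed field, all inertia degrees at maximal ideals are one. -/
theorem inertiaDeg_eq_one (k : Type*) {A B : Type*} [Field k] [IsAlgClosed k] [CommRing A]
    [CommRing B] [Algebra k A] [Algebra k B] [Algebra A B] [IsScalarTower k A B]
    [Algebra.FiniteType k B] (p : Ideal A) (q : Ideal B) [p.IsMaximal] [q.IsMaximal]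
    [q.LiesOver p] : q.inertiaDeg A = 1 := by
  let := Ideal.Quotient.field p
  let := Ideal.Quotient.field q
  have : Module.Finite k (B ⧸ q) := finite_of_finite_type_of_isJacobsonRing k (B ⧸ q)
  have hk := IsAlgClosed.algebraMap_bijective_of_isIntegral (k := k) (K := B ⧸ q)
  rw [Ideal.inertiaDeg_eq_of_isMaximal p q]
  have hs : Function.Surjective (algebraMap (A ⧸ p) (B ⧸ q)) := by
    intro x
    obtain ⟨c, rfl⟩ := hk.2 x
    refine ⟨algebraMap k _ c, ?_⟩
    exact (IsScalarTower.algebraMap_apply k (A ⧸ p) (B ⧸ q) c).symm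
  rw [finrank_eq_one_iff_of_nonzero' (1 : B ⧸ q) one_ne_zero]
  intro x
  obtain ⟨c, rfl⟩ := hs x
  exact ⟨c, by rw [Algebra.smul_def, mul_one]⟩

/-- The formula `∑ e f = n` for a finite flat algebra over a domain, when all residue fields are the
algebraically closed ground field `k`, so that every `f` is one. -/
theorem sum_ramificationIdx (k : Type*) {A B : Type*} [Field k] [IsAlgClosed k] [CommRing A]
    [CommRing B] [Algebra k A] [Algebra k B] [Algebra A B] [IsScalarTower k A B]
    [Algebra.FiniteType k B] [IsDomain A] [Module.Finite A B] [Module.Flat A B]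
    (p : Ideal A) [p.IsMaximal] [Fintype (p.primesOver B)] :
    ∑ q : p.primesOver B, q.1.ramificationIdx A = Module.finrank A B := by
  rw [← Ideal.sum_ramification_inertia_eq_finrank p B]
  refine Finset.sum_congr rfl fun q _ => ?_
  have := q.2.1
  have := q.2.2
  have : q.1.IsMaximal := Ideal.IsMaximal.of_liesOver_isMaximal q.1 p
  rw [inertiaDeg_eq_one k p q.1, mul_one]

end Ramification

/-! ### Points and sections of smooth curves -/

section Curve

variable {k : Type u} [Field k]

/-- `Spec k` is a point, so its only nonempty open is the whole space. -/
theorem isField_Γ_Spec {U : (Spec (.of k)).Opens} (hU : (U : Set (Spec (.of k))).Nonempty) :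
    IsField Γ(Spec (.of k), U) := by
  obtain rfl : U = ⊤ := by
    ext a
    obtain ⟨b, hb⟩ := hU
    simpa [Subsingleton.elim a b] using hb
  exact (Scheme.ΓSpecIso (.of k)).commRingCatIsoToRingEquiv.toMulEquiv.isField
    (Field.toIsField k)

variable (C : ProjectiveCurve k)

theorem ProjectiveCurve.isPrincipalIdealRing_stalk (x : C.X) :
    IsPrincipalIdealRing (C.X.presheaf.stalk x) := by
  obtain ⟨U, hU, V, hV, hx, e, hf⟩ := C.smooth.exists_isStandardSmoothOfRelativeDimension x
  have : Nonempty V := ⟨⟨x, hx⟩⟩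
  have := isDedekindDomain_of_isStandardSmoothOfRelativeDimension_one
    (isField_Γ_Spec ⟨_, e hx⟩) hf
  let := C.X.presheaf.algebra_section_stalk ⟨x, hx⟩
  have := hV.isLocalization_stalk ⟨x, hx⟩
  have : IsDedekindDomain (C.X.presheaf.stalk x) :=
    IsLocalization.isDedekindDomain Γ(C.X, V)
      (hV.primeIdealOf ⟨x, hx⟩).asIdeal.primeCompl_le_nonZeroDivisors _
  infer_instance

instance ProjectiveCurve.isLocallyNoetherian : IsLocallyNoetherian C.X :=
  LocallyOfFiniteType.isLocallyNoetherian C.str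

instance ProjectiveCurve.compactSpace : CompactSpace C.X :=
  QuasiCompact.compactSpace_of_compactSpace C.str

instance ProjectiveCurve.isNoetherian : IsNoetherian C.X where

theorem ProjectiveCurve.isDedekindDomain {U : C.X.Opens} (hU : IsAffineOpen U) [Nonempty U] :
    IsDedekindDomain Γ(C.X, U) := by
  have : IsNoetherianRing Γ(C.X, U) := IsLocallyNoetherian.component_noetherian ⟨U, hU⟩
  refine isDedekindDomain_of_isPrincipalIdealRing_localization fun q hq => ?_
  let y : PrimeSpectrum Γ(C.X, U) := ⟨q, hq⟩
  have hy : hU.fromSpec y ∈ U := (hU.isoSpec.inv y).2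
  let := C.X.presheaf.algebra_section_stalk ⟨hU.fromSpec y, hy⟩
  have : IsLocalization q.primeCompl (C.X.presheaf.stalk (hU.fromSpec y)) :=
    hU.isLocalization_stalk' y hy
  have := C.isPrincipalIdealRing_stalk (hU.fromSpec y)
  let e := IsLocalization.algEquiv q.primeCompl (C.X.presheaf.stalk (hU.fromSpec y))
    (Localization.AtPrime q)
  exact IsPrincipalIdealRing.of_surjective e e.surjective

/-- Only the generic point corresponds to the zero ideal in an affine chart. -/
theorem eq_genericPoint_of_primeIdealOf {X : Scheme.{u}} [IsIntegral X] {U : X.Opens}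
    (hU : IsAffineOpen U) (x : U) (h : (hU.primeIdealOf x).asIdeal = ⊥) :
    x.1 = genericPoint X := by
  have : Nonempty U := ⟨x⟩
  have h1 := hU.primeIdealOf_genericPoint
  rw [genericPoint_eq_bot_of_affine] at h1
  have h2 : hU.primeIdealOf x = ⊥ := PrimeSpectrum.ext h
  rw [← h1] at h2
  have h3 := congrArg hU.fromSpec h2
  rwa [hU.fromSpec_primeIdealOf, hU.fromSpec_primeIdealOf] at h3

/-- The coordinate rings of a curve have dimension at most one, so that a non-generic point has no
proper specializations. -/
theorem ProjectiveCurve.isClosed_singleton {x : C.X} (hx : x ≠ genericPoint C.X) :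
    IsClosed ({x} : Set C.X) := by
  refine isClosed_of_closure_subset fun y hy => ?_
  have hxy : x ⤳ y := specializes_iff_mem_closure.mpr hy
  obtain ⟨U, hU, hyU, -⟩ := Opens.isBasis_iff_nbhd.mp C.X.isBasis_affineOpens
    (show y ∈ (⊤ : C.X.Opens) from trivial)
  have hU : IsAffineOpen U := hU
  have hxU : x ∈ U := hxy.mem_open U.isOpen hyU
  have : Nonempty U := ⟨⟨x, hxU⟩⟩
  have := C.isDedekindDomain hU
  have h1 : hU.primeIdealOf ⟨x, hxU⟩ ⤳ hU.primeIdealOf ⟨y, hyU⟩ := by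
    refine hU.fromSpec.isOpenEmbedding.isInducing.specializes_iff.mp ?_
    rw [hU.fromSpec_primeIdealOf, hU.fromSpec_primeIdealOf]
    exact hxy
  rw [← PrimeSpectrum.le_iff_specializes, ← PrimeSpectrum.asIdeal_le_asIdeal] at h1
  have h2 : (hU.primeIdealOf ⟨x, hxU⟩).asIdeal.IsMaximal :=
    (hU.primeIdealOf ⟨x, hxU⟩).2.isMaximal fun h =>
      hx (eq_genericPoint_of_primeIdealOf hU ⟨x, hxU⟩ h)
  have h3 := h2.eq_of_le (hU.primeIdealOf ⟨y, hyU⟩).2.ne_top h1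
  have h4 := congrArg hU.fromSpec (PrimeSpectrum.ext h3)
  rw [hU.fromSpec_primeIdealOf, hU.fromSpec_primeIdealOf] at h4
  exact h4.symm

/-- By Noetherianity a closed set has finitely many irreducible components; each is the closure of a
point other than the generic one, that is, a closed point. -/
theorem ProjectiveCurve.finite_of_isClosed {Z : Set C.X} (hZ : IsClosed Z)
    (hη : genericPoint C.X ∉ Z) : Z.Finite := by
  obtain ⟨S, hS, hSc, hSi, rfl⟩ := NoetherianSpace.exists_finite_set_isClosed_irreducible hZ
  refine hS.sUnion fun t ht => ?_
  obtain ⟨x, hx⟩ := QuasiSober.sober (hSi t ht) (hSc t ht)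
  have hxt : x ∈ t := hx.mem
  have hxη : x ≠ genericPoint C.X := fun h => hη ⟨t, ht, h ▸ hxt⟩
  have : t = {x} := by
    rw [← hx.def, (C.isClosed_singleton hxη).closure_eq]
  rw [this]
  exact Set.finite_singleton x

end Curve

/-! ### Projective curves are proper -/

section Proper

variable {k : Type u} [Field k]

attribute [local instance] MvPolynomial.gradedAlgebra

instance isProper_projSpaceStr (n : ℕ) : IsProper (projSpaceStr k n) := by
  let 𝒜 := MvPolynomial.homogeneousSubmodule (Fin (n + 1)) k
  -- The degree zero part consists of the constants, so `Spec 𝒜₀ ⟶ Spec k` is a closed immersion.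
  have h0 : Function.Surjective (algebraMap k (𝒜 0)) := by
    rintro ⟨p, hp⟩
    obtain ⟨c, rfl⟩ : ∃ c, MvPolynomial.C c = p := by
      have hp' : p ∈ (1 : Submodule k (MvPolynomial (Fin (n + 1)) k)) := by
        rw [← MvPolynomial.homogeneousSubmodule_zero]
        exact hp
      exact Submodule.mem_one.mp hp'
    exact ⟨c, rfl⟩
  have h1 : IsClosedImmersion (Spec.map (CommRingCat.ofHom (algebraMap k (𝒜 0)))) :=
    IsClosedImmersion.spec_of_surjective _ h0
  have h2 : IsScalarTower k (𝒜 0) (MvPolynomial (Fin (n + 1)) k) :=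
    IsScalarTower.of_algebraMap_eq (R := k) (S := 𝒜 0) (A := MvPolynomial (Fin (n + 1)) k)
      fun c => rfl
  have h3 : Algebra.FiniteType (𝒜 0) (MvPolynomial (Fin (n + 1)) k) :=
    Algebra.FiniteType.of_restrictScalars_finiteType k _ _
  have h4 : IsProper (Proj.toSpecZero 𝒜) := inferInstance
  exact MorphismProperty.comp_mem @IsProper (Proj.toSpecZero 𝒜)
    (Spec.map (CommRingCat.ofHom (algebraMap k (𝒜 0)))) h4 inferInstance

instance ProjectiveCurve.isProper (C : ProjectiveCurve k) : IsProper C.str := by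
  obtain ⟨n, i, hi, h⟩ := C.projective
  rw [← h]
  infer_instance

theorem ProjectiveCurve.isProper_hom {C₁ C₂ : ProjectiveCurve k} {φ : C₁.X ⟶ C₂.X}
    (hφ : φ ≫ C₂.str = C₁.str) : IsProper φ := by
  have : IsProper (φ ≫ C₂.str) := hφ ▸ C₁.isProper
  exact IsProper.of_comp φ C₂.str

end Proper

/-! ### Function fields -/

section FunctionField

theorem stalkMap_germ {X Y : Scheme.{u}} (φ : X ⟶ Y) {U : Y.Opens} {V : X.Opens}
    (e : V ≤ φ ⁻¹ᵁ U) {x : X} (hx : x ∈ V) (a : Γ(Y, U)) :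
    φ.stalkMap x (Y.presheaf.germ U (φ x) (e hx) a) =
      X.presheaf.germ V x hx (φ.appLE U V e a) := by
  simp only [Scheme.Hom.appLE, CommRingCat.comp_apply, TopCat.Presheaf.germ_res_apply]
  exact Scheme.Hom.germ_stalkMap_apply φ U x (e hx) a

variable {X Y : Scheme.{u}} [IsIntegral X] [IsIntegral Y] (φ : X ⟶ Y) [IsDominant φ]

theorem functionFieldMap_algebraMap_stalk (x : X) (a : Y.presheaf.stalk (φ x)) :
    functionFieldMap φ (algebraMap _ Y.functionField a) =
      algebraMap (X.presheaf.stalk x) X.functionField (φ.stalkMap x a) := by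
  have h1 := φ.stalkSpecializes_stalkMap_apply (genericPoint X) x
    ((genericPoint_spec X).specializes trivial) a
  refine Eq.trans ?_ h1
  change φ.stalkMap (genericPoint X) (Y.presheaf.stalkSpecializes _
    (Y.presheaf.stalkSpecializes _ a)) = _
  congr 1
  exact congr($(Y.presheaf.stalkSpecializes_comp _ _) a)

theorem functionFieldMap_algebraMap {U : Y.Opens} {V : X.Opens} (e : V ≤ φ ⁻¹ᵁ U) [Nonempty U]
    [Nonempty V] (a : Γ(Y, U)) :
    functionFieldMap φ (algebraMap _ Y.functionField a) =
      algebraMap Γ(X, V) X.functionField (φ.appLE U V e a) := by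
  obtain ⟨x⟩ := ‹Nonempty V›
  have h1 := functionFieldMap_algebraMap_stalk φ x.1 (Y.presheaf.germ U (φ x.1) (e x.2) a)
  have h0 := congrArg (functionFieldMap φ)
    (Scheme.algebraMap_germ_eq_germToFunctionField Y (e x.2) a)
  refine h0.symm.trans (h1.trans ?_)
  have h2 := Scheme.algebraMap_germ_eq_germToFunctionField X x.2 (φ.appLE U V e a)
  refine Eq.trans ?_ h2
  rw [stalkMap_germ φ e x.2]

theorem stalkMap_injective (x : X) : Function.Injective (φ.stalkMap x) := by
  have h : Function.Injective (algebraMap (X.presheaf.stalk x) X.functionField ∘ φ.stalkMap x) := by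
    have : (algebraMap (X.presheaf.stalk x) X.functionField ∘ φ.stalkMap x) =
        functionFieldMap φ ∘ algebraMap (Y.presheaf.stalk (φ x)) Y.functionField :=
      funext fun a => (functionFieldMap_algebraMap_stalk φ x a).symm
    rw [this]
    exact (functionFieldMap φ).injective.comp (IsFractionRing.injective _ _)
  exact h.of_comp

end FunctionField

/-! ### Flatness and finiteness of morphisms of curves -/

section Hom

variable {k : Type u} [Field k] {C₁ C₂ : ProjectiveCurve k} (φ : C₁.X ⟶ C₂.X) [IsDominant φ]

/-- A dominant morphism of smooth curves is flat: its stalk maps are injective, and over a principal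
ideal domain torsion-free modules are flat. -/
theorem ProjectiveCurve.flat : Flat φ := by
  refine Flat.of_stalkMap φ fun x => ?_
  have := C₂.isPrincipalIdealRing_stalk (φ x)
  algebraize [(φ.stalkMap x).hom]
  have : Module.IsTorsionFree (C₂.X.presheaf.stalk (φ x)) (C₁.X.presheaf.stalk x) := by
    have : FaithfulSMul (C₂.X.presheaf.stalk (φ x)) (C₁.X.presheaf.stalk x) :=
      (faithfulSMul_iff_algebraMap_injective _ _).mpr (stalkMap_injective φ x)
    infer_instance
  change Module.Flat _ _
  infer_instance

/-- If the function field extension is algebraic, then only the generic point lies over the generic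
point. -/
theorem ProjectiveCurve.eq_genericPoint_of_map
    (halg : letI := (functionFieldMap φ).toAlgebra
      Algebra.IsAlgebraic C₂.X.functionField C₁.X.functionField)
    {x : C₁.X} (hx : φ x = genericPoint C₂.X) : x = genericPoint C₁.X := by
  let := (functionFieldMap φ).toAlgebra
  let := (φ.stalkMap x).hom.toAlgebra
  have hK : IsField (C₂.X.presheaf.stalk (φ x)) := by
    rw [hx]
    exact Field.toIsField C₂.X.functionField
  let := hK.toField
  -- The stalk at `x` is algebraic over the function field of the target, so it is a field.
  have hS : IsField (C₁.X.presheaf.stalk x) := by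
    let := ((algebraMap _ C₁.X.functionField).comp
      (φ.stalkMap x).hom).toAlgebra
    have h1 : IsScalarTower (C₂.X.presheaf.stalk (φ x)) (C₁.X.presheaf.stalk x)
      C₁.X.functionField := IsScalarTower.of_algebraMap_eq fun _ => rfl
    have h2 : IsScalarTower (C₂.X.presheaf.stalk (φ x)) C₂.X.functionField
      C₁.X.functionField :=
        IsScalarTower.of_algebraMap_eq fun a => (functionFieldMap_algebraMap_stalk φ x a).symm
    have h3 : Algebra.IsAlgebraic (C₂.X.presheaf.stalk (φ x)) C₁.X.functionField :=
      (IsFractionRing.comap_isAlgebraic_iff (A := C₂.X.presheaf.stalk (φ x))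
        (K := C₂.X.functionField) (C := C₁.X.functionField)).mpr halg
    have h4 : Algebra.IsAlgebraic (C₂.X.presheaf.stalk (φ x)) (C₁.X.presheaf.stalk x) :=
      Algebra.IsAlgebraic.tower_bot_of_injective
        (IsFractionRing.injective (C₁.X.presheaf.stalk x) C₁.X.functionField)
    have h5 : Algebra.IsIntegral (C₂.X.presheaf.stalk (φ x)) (C₁.X.presheaf.stalk x) :=
      inferInstance
    exact isField_of_isIntegral_of_isField' hK
  obtain ⟨U, hU, hxU, -⟩ := Opens.isBasis_iff_nbhd.mp C₁.X.isBasis_affineOpens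
    (show x ∈ (⊤ : C₁.X.Opens) from trivial)
  have hU : IsAffineOpen U := hU
  have : Nonempty U := ⟨⟨x, hxU⟩⟩
  let := C₁.X.presheaf.algebra_section_stalk ⟨x, hxU⟩
  have := hU.isLocalization_stalk ⟨x, hxU⟩
  -- A localization of a domain at a nonzero prime is not a field.
  refine eq_genericPoint_of_primeIdealOf hU ⟨x, hxU⟩ (by_contra fun h => ?_)
  exact IsLocalization.AtPrime.not_isField Γ(C₁.X, U) h (C₁.X.presheaf.stalk x) hS

/-- A morphism of smooth projective curves with algebraic function field extension is proper, since
the curves are, and has finite fibres. By Zariski's main theorem it is finite. -/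
theorem ProjectiveCurve.isFinite (hφ : φ ≫ C₂.str = C₁.str)
    (halg : letI := (functionFieldMap φ).toAlgebra
      Algebra.IsAlgebraic C₂.X.functionField C₁.X.functionField) : IsFinite φ := by
  have := ProjectiveCurve.isProper_hom hφ
  have : LocallyQuasiFinite φ := by
    refine LocallyQuasiFinite.of_finite_preimage_singleton φ fun y => ?_
    by_cases hy : y = genericPoint C₂.X
    · exact (Set.finite_singleton (genericPoint C₁.X)).subset fun x hx =>
        ProjectiveCurve.eq_genericPoint_of_map φ halg (hx.trans hy)
    -- The other fibres are closed and do not contain the generic point.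
    · refine C₁.finite_of_isClosed ((C₂.isClosed_singleton hy).preimage φ.continuous) fun h => ?_
      exact hy ((map_genericPoint φ) ▸ h.symm)
  exact IsFinite.of_isProper_of_locallyQuasiFinite φ

end Hom

/-! ### Ramification and degree on affine opens -/

section Affine

/-- Ramification indices, defined on stalks, can be computed in affine charts. Flatness makes
ramification indices multiplicative. -/
theorem ramificationIndex_eq {X Y : Scheme.{u}} (φ : X ⟶ Y) [Flat φ] {U : Y.Opens} {V : X.Opens}
    (hU : IsAffineOpen U) (hV : IsAffineOpen V) (e : V ≤ φ ⁻¹ᵁ U) {x : X} (hx : x ∈ V) :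
    ramificationIndex φ x = letI := (φ.appLE U V e).hom.toAlgebra
      (hV.primeIdealOf ⟨x, hx⟩).asIdeal.ramificationIdx Γ(Y, U) := by
  let := (φ.appLE U V e).hom.toAlgebra
  let := (φ.stalkMap x).hom.toAlgebra
  let := Y.presheaf.algebra_section_stalk ⟨φ x, e hx⟩
  let := X.presheaf.algebra_section_stalk ⟨x, hx⟩
  let := ((φ.stalkMap x).hom.comp (algebraMap Γ(Y, U) (Y.presheaf.stalk (φ x)))).toAlgebra
  have : IsScalarTower Γ(Y, U) (Y.presheaf.stalk (φ x)) (X.presheaf.stalk x) :=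
    IsScalarTower.of_algebraMap_eq fun _ => rfl
  have : IsScalarTower Γ(Y, U) Γ(X, V) (X.presheaf.stalk x) :=
    IsScalarTower.of_algebraMap_eq fun a => stalkMap_germ φ e hx a
  have := hU.isLocalization_stalk ⟨φ x, e hx⟩
  have := hV.isLocalization_stalk ⟨x, hx⟩
  have : (hV.primeIdealOf ⟨x, hx⟩).asIdeal.LiesOver (hU.primeIdealOf ⟨φ x, e hx⟩).asIdeal :=
    ⟨congr($(IsAffineOpen.comap_primeIdealOf_appLE U hU V hV e hx).1).symm⟩
  have : Module.Flat (Y.presheaf.stalk (φ x)) (X.presheaf.stalk x) := Flat.stalkMap φ x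
  have : IsLocalHom (algebraMap (Y.presheaf.stalk (φ x)) (X.presheaf.stalk x)) :=
    inferInstanceAs (IsLocalHom (φ.stalkMap x).hom)
  exact ramificationIdx_localization (A := Γ(Y, U)) (B := Γ(X, V)) (S := Y.presheaf.stalk (φ x))
    (T := X.presheaf.stalk x) (hU.primeIdealOf ⟨φ x, e hx⟩).asIdeal
    (hV.primeIdealOf ⟨x, hx⟩).asIdeal

variable {X Y : Scheme.{u}} [IsIntegral X] [IsIntegral Y] (φ : X ⟶ Y) [IsDominant φ]

/-- The degree of a finite morphism is the rank of its sections over any nonempty affine open: both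
function fields are fraction fields of sections. -/
theorem degree_eq_finrank [IsFinite φ] {U : Y.Opens} (hU : IsAffineOpen U) [Nonempty U] :
    degree φ = letI := (φ.app U).hom.toAlgebra
      Module.finrank Γ(Y, U) Γ(X, φ ⁻¹ᵁ U) := by
  have hV : IsAffineOpen (φ ⁻¹ᵁ U) := hU.preimage φ
  have : Nonempty (φ ⁻¹ᵁ U) := by
    obtain ⟨y⟩ := ‹Nonempty U›
    refine ⟨⟨genericPoint X, ?_⟩⟩
    change φ (genericPoint X) ∈ U
    rw [map_genericPoint]
    exact ((genericPoint_spec Y).mem_open_set_iff U.isOpen).mpr ⟨y.1, trivial, y.2⟩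
  let := (φ.app U).hom.toAlgebra
  let := (functionFieldMap φ).toAlgebra
  let := ((functionFieldMap φ).comp (algebraMap Γ(Y, U) Y.functionField)).toAlgebra
  have : IsScalarTower Γ(Y, U) Y.functionField X.functionField :=
    IsScalarTower.of_algebraMap_eq fun _ => rfl
  have : IsScalarTower Γ(Y, U) Γ(X, φ ⁻¹ᵁ U) X.functionField :=
    IsScalarTower.of_algebraMap_eq fun a => by
      have := functionFieldMap_algebraMap φ (U := U) (V := φ ⁻¹ᵁ U) le_rfl a
      rw [Scheme.Hom.appLE_eq_app] at this
      exact this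
  have := functionField_isFractionRing_of_isAffineOpen Y U hU
  have := functionField_isFractionRing_of_isAffineOpen X _ hV
  have h1 := IsFractionRing.finrank_right_eq Γ(Y, U) (S := Y.functionField) X.functionField
  have h2 := IsFractionRing.finrank_left_eq Γ(Y, U) (S := Γ(X, φ ⁻¹ᵁ U)) X.functionField
  exact h1.trans h2.symm

/-- A separable morphism is unramified at the generic point, as separable field extensions are
formally unramified, in any characteristic. -/
theorem isUnramifiedAt_bot (hsep : IsSeparableMorphism φ) {U : Y.Opens} {V : X.Opens}
    (hU : IsAffineOpen U) (hV : IsAffineOpen V) (e : V ≤ φ ⁻¹ᵁ U) [Nonempty V] [Nonempty U] :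
    letI := (φ.appLE U V e).hom.toAlgebra
    Algebra.IsUnramifiedAt Γ(Y, U) (⊥ : Ideal Γ(X, V)) := by
  let := (φ.appLE U V e).hom.toAlgebra
  let := (functionFieldMap φ).toAlgebra
  let := ((functionFieldMap φ).comp (algebraMap Γ(Y, U) Y.functionField)).toAlgebra
  have : IsScalarTower Γ(Y, U) Y.functionField X.functionField :=
    IsScalarTower.of_algebraMap_eq fun _ => rfl
  have : IsScalarTower Γ(Y, U) Γ(X, V) X.functionField :=
    IsScalarTower.of_algebraMap_eq fun a => functionFieldMap_algebraMap φ e a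
  have := functionField_isFractionRing_of_isAffineOpen Y U hU
  have := functionField_isFractionRing_of_isAffineOpen X V hV
  have : Algebra.IsSeparable Y.functionField X.functionField := hsep
  have h1 : Algebra.FormallyUnramified Γ(Y, U) Y.functionField :=
    Algebra.FormallyUnramified.of_isLocalization (nonZeroDivisors Γ(Y, U))
  have h2 : Algebra.FormallyUnramified Y.functionField X.functionField :=
    Algebra.FormallyUnramified.of_isSeparable _ _
  have h3 : Algebra.FormallyUnramified Γ(Y, U) X.functionField :=
    Algebra.FormallyUnramified.comp _ Y.functionField _
  have h4 : IsLocalization (⊥ : Ideal Γ(X, V)).primeCompl X.functionField := by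
    rw [Ideal.primeCompl_bot]
    infer_instance
  let E : X.functionField ≃ₐ[Γ(X, V)] Localization.AtPrime (⊥ : Ideal Γ(X, V)) :=
    IsLocalization.algEquiv (⊥ : Ideal Γ(X, V)).primeCompl _ _
  exact Algebra.FormallyUnramified.of_equiv (E.restrictScalars Γ(Y, U))

/-- A separable morphism is unramified at the generic point, hence in a neighbourhood of it, as
unramifiedness is an open condition for morphisms of finite type. -/
theorem exists_open_ramificationIndex_eq_one (hsep : IsSeparableMorphism φ) [Flat φ]
    [LocallyOfFiniteType φ] : ∃ W : X.Opens, genericPoint X ∈ W ∧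
      ∀ x ∈ W, ramificationIndex φ x = 1 := by
  obtain ⟨U, hU, hxU, -⟩ := Opens.isBasis_iff_nbhd.mp Y.isBasis_affineOpens
    (show φ (genericPoint X) ∈ (⊤ : Y.Opens) from trivial)
  have hU : IsAffineOpen U := hU
  obtain ⟨V, hV, hxV, e⟩ := Opens.isBasis_iff_nbhd.mp X.isBasis_affineOpens
    (show genericPoint X ∈ φ ⁻¹ᵁ U from hxU)
  have hV : IsAffineOpen V := hV
  have : Nonempty U := ⟨⟨_, hxU⟩⟩
  have : Nonempty V := ⟨⟨_, hxV⟩⟩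
  let := (φ.appLE U V e).hom.toAlgebra
  have := isUnramifiedAt_bot φ hsep hU hV e
  have hft : Algebra.FiniteType Γ(Y, U) Γ(X, V) := φ.finiteType_appLE hU hV e
  obtain ⟨f, hf, hunr⟩ :=
    Algebra.exists_formallyUnramified_of_isUnramifiedAt (R := Γ(Y, U)) (⊥ : Ideal Γ(X, V))
  have hW : ∀ {x : X} (hx : x ∈ V), x ∈ X.basicOpen f ↔
      f ∉ (hV.primeIdealOf ⟨x, hx⟩).asIdeal := by
    intro x hx
    have h1 : hV.primeIdealOf ⟨x, hx⟩ ∈ hV.fromSpec ⁻¹ᵁ X.basicOpen f ↔ x ∈ X.basicOpen f := by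
      change hV.fromSpec (hV.primeIdealOf ⟨x, hx⟩) ∈ X.basicOpen f ↔ _
      rw [hV.fromSpec_primeIdealOf]
    rw [← h1, hV.fromSpec_preimage_basicOpen]
    rfl
  refine ⟨X.basicOpen f, ?_, fun x hx => ?_⟩
  · rw [hW hxV, hV.primeIdealOf_genericPoint, genericPoint_eq_bot_of_affine]
    exact hf
  · have hxV := X.basicOpen_le f hx
    rw [ramificationIndex_eq φ hU hV e hxV]
    have : Algebra.IsUnramifiedAt Γ(Y, U) (hV.primeIdealOf ⟨x, hxV⟩).asIdeal :=
      (Algebra.basicOpen_subset_unramifiedLocus_iff (R := Γ(Y, U)) (f := f)).mpr hunr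
      ((hW hxV).mp hx)
    exact Ideal.ramificationIdx_eq_one _ _

end Affine

/-! ### Sums over fibres -/

theorem ramificationIndex_eq_of_preimage {X Y : Scheme.{u}} (φ : X ⟶ Y) [Flat φ] {U : Y.Opens}
    (hU : IsAffineOpen U) (hV : IsAffineOpen (φ ⁻¹ᵁ U)) {x : X} (hx : x ∈ φ ⁻¹ᵁ U) :
    ramificationIndex φ x = letI := (φ.app U).hom.toAlgebra
      (hV.primeIdealOf ⟨x, hx⟩).asIdeal.ramificationIdx Γ(Y, U) := by
  have h := ramificationIndex_eq φ hU hV le_rfl hx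
  rwa [Scheme.Hom.appLE_eq_app] at h

section Fibre

variable {k : Type u} [Field k]

theorem Variety.finiteType_scalars (V : Variety k) {U : V.X.Opens} (hU : IsAffineOpen U) :
    (V.scalars U).FiniteType := by
  unfold Variety.scalars
  rw [CommRingCat.hom_comp]
  exact (V.str.finiteType_appLE (isAffineOpen_top _) hU le_top).comp
    (RingHom.FiniteType.of_surjective _
      (ConcreteCategory.bijective_of_isIso (Scheme.ΓSpecIso (.of k)).inv).2)

theorem Variety.app_scalars {V W : Variety k} (φ : V.X ⟶ W.X) (hφ : φ ≫ W.str = V.str)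
    (U : W.X.Opens) (c : k) : φ.app U (W.scalars U c) = V.scalars (φ ⁻¹ᵁ U) c := by
  have h := Scheme.Hom.appLE_comp_appLE φ W.str ⊤ U (φ ⁻¹ᵁ U) le_top le_rfl
  simp only [hφ, Scheme.Hom.appLE_eq_app] at h
  exact congr($h ((Scheme.ΓSpecIso (.of k)).inv c))

variable {C₁ C₂ : ProjectiveCurve k} (φ : C₁.X ⟶ C₂.X)

theorem finite_fibre [IsFinite φ] (y : C₂.Pt) :
    (fibre (V := C₁.toVariety) (W := C₂.toVariety) φ y).Finite :=
  (φ.finite_preimage_singleton y.1).preimage Subtype.val_injective.injOn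

/-- The points of the scheme over a closed point are closed, because fibres of a finite morphism are
discrete. Hence the closed points
over `y` are all the points over `y`. -/
theorem isClosed_of_map_eq [IsFinite φ] {x : C₁.X} {y : C₂.Pt} (h : φ x = y.1) :
    IsClosed ({x} : Set C₁.X) := by
  refine isClosed_of_closure_subset fun x' hx' => ?_
  have h0 : ({x} : Set C₁.X) ⊆ φ ⁻¹' {y.1} := Set.singleton_subset_iff.mpr h
  have h1 : x' ∈ φ ⁻¹' {y.1} := closure_minimal h0 (y.2.preimage φ.continuous) hx'
  exact ((φ.isDiscrete_preimage_singleton y.1).eq_of_specializes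
    (specializes_iff_mem_closure.mpr hx') h h1).symm

/-- The ramification indices over a closed point `y` add up to the degree. In an affine chart `U`
around `y` this is `∑ e f = n` for the finite flat extension `Γ(C₁, φ⁻¹U) / Γ(C₂, U)`, and the
points over `y` correspond to the primes over the maximal ideal of `y`. -/
theorem sum_ramificationIndex_fibre [IsAlgClosed k] [IsDominant φ] [IsFinite φ]
    (hφ : φ ≫ C₂.str = C₁.str) (y : C₂.Pt) :
    ∑ x ∈ (finite_fibre φ y).toFinset, ramificationIndex φ x.1 = degree φ := by
  have := ProjectiveCurve.flat φ
  obtain ⟨U, hU, hyU, -⟩ := Opens.isBasis_iff_nbhd.mp C₂.X.isBasis_affineOpens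
    (show y.1 ∈ (⊤ : C₂.X.Opens) from trivial)
  have hU : IsAffineOpen U := hU
  have hV : IsAffineOpen (φ ⁻¹ᵁ U) := hU.preimage φ
  have : Nonempty U := ⟨⟨_, hyU⟩⟩
  let := (φ.app U).hom.toAlgebra
  let := (C₂.toVariety.scalars U).toAlgebra
  let := (C₁.toVariety.scalars (φ ⁻¹ᵁ U)).toAlgebra
  have : IsScalarTower k Γ(C₂.X, U) Γ(C₁.X, φ ⁻¹ᵁ U) :=
    IsScalarTower.of_algebraMap_eq fun c =>
      (Variety.app_scalars (V := C₁.toVariety) (W := C₂.toVariety) φ hφ U c).symm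
  have hft : Algebra.FiniteType k Γ(C₁.X, φ ⁻¹ᵁ U) := C₁.toVariety.finiteType_scalars hV
  have hfin : Module.Finite Γ(C₂.X, U) Γ(C₁.X, φ ⁻¹ᵁ U) := φ.finite_app U hU
  have hflat : Module.Flat Γ(C₂.X, U) Γ(C₁.X, φ ⁻¹ᵁ U) := by
    have := φ.flat_appLE hU hV le_rfl
    rw [Scheme.Hom.appLE_eq_app] at this
    exact this
  have hp : (hU.primeIdealOf ⟨y.1, hyU⟩).asIdeal.IsMaximal :=
    hU.primeIdealOf_isMaximal_of_isClosed ⟨y.1, hyU⟩ y.2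
  have : Fintype ((hU.primeIdealOf ⟨y.1, hyU⟩).asIdeal.primesOver Γ(C₁.X, φ ⁻¹ᵁ U)) :=
    (Algebra.QuasiFinite.finite_primesOver _).fintype
  rw [degree_eq_finrank φ hU, ← sum_ramificationIdx k (hU.primeIdealOf ⟨y.1, hyU⟩).asIdeal]
  have hmem : ∀ {x : C₁.Pt}, x ∈ (finite_fibre φ y).toFinset ↔ φ x.1 = y.1 := by
    intro x
    rw [Set.Finite.mem_toFinset]
    rfl
  have hU' : ∀ {x : C₁.Pt}, x ∈ (finite_fibre φ y).toFinset → x.1 ∈ φ ⁻¹ᵁ U := by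
    intro x hx
    rw [Scheme.Hom.mem_preimage, hmem.mp hx]
    exact hyU
  have hcomap : ∀ {x : C₁.X} (hx : x ∈ φ ⁻¹ᵁ U),
      (hV.primeIdealOf ⟨x, hx⟩).comap (φ.app U).hom = hU.primeIdealOf ⟨φ x, hx⟩ := by
    intro x hx
    have := IsAffineOpen.comap_primeIdealOf_appLE (f := φ) U hU (φ ⁻¹ᵁ U) hV le_rfl hx
    simpa only [Scheme.Hom.appLE_eq_app] using this
  -- A point over `y` is sent to its prime ideal in `Γ(C₁, φ⁻¹U)`.
  refine Finset.sum_bij (fun x hx => ⟨(hV.primeIdealOf ⟨x.1, hU' hx⟩).asIdeal,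
    (hV.primeIdealOf ⟨x.1, hU' hx⟩).2, ⟨?_⟩⟩) (fun _ _ => Finset.mem_univ _) ?_ ?_ ?_
  · have h1 := congrArg PrimeSpectrum.asIdeal (hcomap (hU' hx))
    simp only [hmem.mp hx] at h1
    exact h1.symm
  · intro x hx x' hx' h
    have h1 := congrArg hV.fromSpec (PrimeSpectrum.ext (congrArg Subtype.val h))
    rw [hV.fromSpec_primeIdealOf, hV.fromSpec_primeIdealOf] at h1
    exact Subtype.ext h1
  · rintro ⟨q, hq, hqp⟩ -
    let z : PrimeSpectrum Γ(C₁.X, φ ⁻¹ᵁ U) := ⟨q, hq⟩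
    have hz : hV.fromSpec z ∈ φ ⁻¹ᵁ U := (hV.isoSpec.inv z).2
    have hzq : hV.primeIdealOf ⟨hV.fromSpec z, hz⟩ = z :=
      hV.fromSpec.isOpenEmbedding.injective (hV.fromSpec_primeIdealOf _)
    have h1 := hcomap hz
    have h2 : z.comap (φ.app U).hom = hU.primeIdealOf ⟨y.1, hyU⟩ :=
      PrimeSpectrum.ext hqp.over.symm
    rw [hzq, h2] at h1
    have h3 := congrArg hU.fromSpec h1
    rw [hU.fromSpec_primeIdealOf, hU.fromSpec_primeIdealOf] at h3
    exact ⟨⟨_, isClosed_of_map_eq φ h3.symm⟩, hmem.mpr h3.symm,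
      Subtype.ext (congrArg PrimeSpectrum.asIdeal hzq)⟩
  · intro x hx
    exact ramificationIndex_eq_of_preimage φ hU hV (hU' hx)

variable [IsAlgClosed k] {R : Type v} [CommRing R] (χ : EulerCharacteristic k R)

/-- Summing a finitely supported function over the fibres gives its integral over the source. -/
theorem integral_sum_fibre [IsFinite φ] {g : C₁.Pt → R} (hg : (Function.support g).Finite) :
    (fun y => ∑ x ∈ (finite_fibre φ y).toFinset, g x) ∈ C₂.toVariety.integrable R ∧
      χ.integral C₂.toVariety (fun y => ∑ x ∈ (finite_fibre φ y).toFinset, g x) =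
        ∑ᶠ x, g x := by
  classical
  -- A finite morphism is closed, so it maps closed points to closed points.
  let Φ : C₁.Pt → C₂.Pt := fun x => ⟨φ x.1, by
    have h := φ.isClosedMap _ x.2
    rwa [Set.image_singleton] at h⟩
  have hG : ∀ y, ∑ x ∈ (finite_fibre φ y).toFinset, g x =
      ∑ x ∈ hg.toFinset with Φ x = y, g x := by
    intro y
    refine (Finset.sum_subset_zero_on_sdiff ?_ ?_ fun _ _ => rfl).symm
    · intro x hx
      rw [Set.Finite.mem_toFinset]
      exact congrArg Subtype.val (Finset.mem_filter.mp hx).2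
    · intro x hx
      rw [Finset.mem_sdiff, Set.Finite.mem_toFinset, Finset.mem_filter,
        Set.Finite.mem_toFinset] at hx
      by_contra h0
      exact hx.2 ⟨h0, Subtype.ext hx.1⟩
  have hsupp : Function.support (fun y => ∑ x ∈ (finite_fibre φ y).toFinset, g x) ⊆
      hg.toFinset.image Φ := by
    intro y hy
    rw [Function.mem_support, hG] at hy
    obtain ⟨x, hx, -⟩ := Finset.exists_ne_zero_of_sum_ne_zero hy
    exact Finset.mem_coe.mpr (Finset.mem_image.mpr ⟨x, Finset.mem_filter.mp hx⟩)
  obtain ⟨h1, h2⟩ := χ.integral_of_finite_support (V := C₂.toVariety) _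
    ((Finset.finite_toSet _).subset hsupp)
  refine ⟨h1, h2.trans ?_⟩
  rw [finsum_eq_sum_of_support_subset _ hsupp, finsum_eq_sum _ hg]
  simp only [hG]
  exact Finset.sum_fiberwise_of_maps_to (fun x hx => Finset.mem_image_of_mem Φ hx) _

end Fibre

/-! ### Fubini's theorem and the Riemann–Hurwitz formula -/

section RiemannHurwitz

variable {k : Type u} [Field k] {C₁ C₂ : ProjectiveCurve k} (φ : C₁.X ⟶ C₂.X) [IsDominant φ]

theorem ProjectiveCurve.isFinite_of_isSeparable (hφ : φ ≫ C₂.str = C₁.str)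
    (hsep : IsSeparableMorphism φ) : IsFinite φ := by
  refine ProjectiveCurve.isFinite φ hφ ?_
  let := (functionFieldMap φ).toAlgebra
  have : Algebra.IsSeparable C₂.X.functionField C₁.X.functionField := hsep
  exact Algebra.IsSeparable.isAlgebraic _ _

/-- A separable morphism of smooth curves is ramified at finitely many points. -/
theorem finite_ramificationIndex_ne_one [IsFinite φ] (hsep : IsSeparableMorphism φ) :
    {x : C₁.Pt | ramificationIndex φ x.1 ≠ 1}.Finite := by
  have := ProjectiveCurve.flat φ
  obtain ⟨W, hη, hW⟩ := exists_open_ramificationIndex_eq_one φ hsep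
  have hfin : (W : Set C₁.X)ᶜ.Finite :=
    C₁.finite_of_isClosed W.isOpen.isClosed_compl fun h => h hη
  exact (hfin.preimage Subtype.val_injective.injOn).subset fun x hx h => hx (hW _ h)

variable [IsAlgClosed k] {R : Type v} [CommRing R] (χ : EulerCharacteristic k R)

/-- The Euler characteristic of a fibre is the degree, corrected by the ramification over the
point: the fibre has as many points as `∑ 1 = ∑ e_x - ∑ (e_x - 1)`. -/
theorem ofVariety_fibre [IsFinite φ] (hφ : φ ≫ C₂.str = C₁.str) (y : C₂.Pt) :
    χ.ofVariety C₁.toVariety (fibre (V := C₁.toVariety) (W := C₂.toVariety) φ y) =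
      (degree φ : R) -
        ∑ x ∈ (finite_fibre φ y).toFinset, ((ramificationIndex φ x.1 : R) - 1) := by
  rw [χ.ofVariety_finite (finite_fibre φ y), Finset.sum_sub_distrib, ← Nat.cast_sum,
    sum_ramificationIndex_fibre φ hφ y, Finset.sum_const, nsmul_eq_mul, mul_one,
    Set.ncard_eq_toFinset_card _ (finite_fibre φ y), sub_sub_cancel]

end RiemannHurwitz

end EulerFubini

end

theorem mainTheorem6 {k : Type u} [Field k] [IsAlgClosed k] {R : Type v} [CommRing R]
    (χ : EulerFubini.EulerCharacteristic k R)
    (C₁ C₂ : EulerFubini.ProjectiveCurve k)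
    (φ : C₁.X ⟶ C₂.X) (hφ : φ ≫ C₂.str = C₁.str) [IsDominant φ]
    (hsep : EulerFubini.IsSeparableMorphism φ) :
    {x : C₁.Pt | EulerFubini.ramificationIndex φ x.1 ≠ 1}.Finite ∧
    (EulerFubini.FubiniHolds χ (V := C₁.toVariety) (W := C₂.toVariety) φ ↔
      χ.ofVariety C₁.toVariety Set.univ =
        χ.ofVariety C₂.toVariety Set.univ * (EulerFubini.degree φ : R) -
          ∑ᶠ x : C₁.Pt, ((EulerFubini.ramificationIndex φ x.1 : R) - 1)) := by
  open EulerFubini in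
  have := ProjectiveCurve.isFinite_of_isSeparable φ hφ hsep
  have hS := finite_ramificationIndex_ne_one φ hsep
  refine ⟨hS, ?_⟩
  have hg : (Function.support fun x : C₁.Pt => -((ramificationIndex φ x.1 : R) - 1)).Finite :=
    hS.subset fun x hx h => hx (by simp [h])
  -- The function `y ↦ χ(φ⁻¹(y))` is the constant `deg φ` plus a finitely supported function.
  obtain ⟨h1, h2⟩ := χ.integral_const (V := C₂.toVariety) (degree φ : R)
  obtain ⟨h3, h4⟩ := integral_sum_fibre φ χ hg
  have hfun : (fun y => χ.ofVariety C₁.toVariety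
      (fibre (V := C₁.toVariety) (W := C₂.toVariety) φ y)) =
      (fun _ => (degree φ : R)) + fun y =>
        ∑ x ∈ (finite_fibre φ y).toFinset, -((ramificationIndex φ x.1 : R) - 1) := by
    ext y
    rw [ofVariety_fibre φ χ hφ y, Pi.add_apply, Finset.sum_neg_distrib, sub_eq_add_neg]
  have hint : χ.integral C₂.toVariety (fun y => χ.ofVariety C₁.toVariety
      (fibre (V := C₁.toVariety) (W := C₂.toVariety) φ y)) =
      χ.ofVariety C₂.toVariety Set.univ * (degree φ : R) -
        ∑ᶠ x : C₁.Pt, ((ramificationIndex φ x.1 : R) - 1) := by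
    rw [hfun, χ.integral_add h1 h3, h2, h4, finsum_neg_distrib, sub_eq_add_neg]
  refine ⟨fun h => h.eq_integral.trans hint, fun h => ⟨fun y => ?_, ?_, h.trans hint.symm⟩⟩
  · exact Variety.isConstructible_finite (finite_fibre φ y)
  · exact hfun ▸ Submodule.add_mem _ h1 h3
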